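/- Let $\mathcal H_A,\mathcal H_B$ be finite-dimensional complex Hilbert spaces and let $|\psi\rangle\in\mathcal H_A\otimes\mathcal H_B$ be a unit vector, $\psi=|\psi\rangle\langle\psi|$. All logarithms are to base $2$, and $\log 0=-\infty$. A Schmidt decomposition of $|\psi\rangle$ is $|\psi\rangle=\sum_{i=1}^d\sqrt{\lambda_i}\,|u_i\rangle\otimes|v_i\rangle$ with orthonormal $u_1,\dots,u_d\in\mathcal H_A$, orthonormal $v_1,\dots,v_d\in\mathcal H_B$ and $\lambda_1\ge\dots\ge\lambda_d\ge0$; the $\lambda_i$ are the Schmidt coefficients of $\psi$, which are, up to zeros, the eigenvalues of $\mathrm{Tr}_B\,\psi$. For $\beta\in[0,+\infty]$ the Rényi entropy of entanglement is $E_\beta(\psi)=H_\beta(\lambda)$, where $H_\beta(\lambda)=\frac1{1-\beta}\log\sum_i\lambda_i^\beta$ for $\beta\ne0,1,+\infty$, $H_1(\lambda)=-\sum_i\lambda_i\log\lambda_i$ (with $0\log 0=0$), $H_0(\lambda)=\log\#\{i:\lambda_i\neq0\}$ and $H_{+\infty}(\lambda)=-\log\max_i\lambda_i$. For density operators $\rho,\sigma$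 and $\alpha\in[0,+\infty)$, let $$S_\alpha(\rho\|\sigma)=\begin{cases}\frac1{\alpha-1}\log\mathrm{Tr}(\rho^\alpha\sigma^{1-\alpha}) & \alpha\in[0,1),\text{ or }\alpha>1\text{ and }\operatorname{supp}\rho\subseteq\operatorname{supp}\sigma,\\ \mathrm{Tr}\big(\rho(\log\rho-\log\sigma)\big)&\alpha=1\text{ and }\operatorname{supp}\rho\subseteq\operatorname{supp}\sigma,\\ +\infty&\text{otherwise,}\end{cases}$$ where powers and logarithms of a positive semidefinite operator are taken on its support and are zero on its kernel (in particular $\rho^0$ is the projection onto the support of $\rho$). A density operator $\sigma$ on $\mathcal H_A\otimes\mathcal H_B$ is separable if $\sigma=\sum_i\tau_i\otimes\omega_i$ is a finite sum with positive semidefinite $\tau_i$ on $\mathcal H_A$ and $\omega_i$ on $\mathcal H_B$. Let $E_{R,\alpha}(\rho)=\inf_\sigma S_\alpha(\rho\|\sigma)$, the infimum being over all separable density operators $\sigma$. Then, for every $\alpha\in[0,2]$, $$E_{R,\alpha}(\psi)=E_{1/\alpha}(\psi),$$ where $1/0=+\infty$. Moreover, for every Schmidt decomposition of $|\psi\rangle$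 as above, the infimum defining $E_{R,\alpha}(\psi)$ is attained: for $\alpha\in(0,2]$ at the separable state $$\sigma=\frac1{\sum_j\lambda_j^{1/\alpha}}\sum_{i=1}^d\lambda_i^{1/\alpha}\,|u_i\rangle\langle u_i|\otimes|v_i\rangle\langle v_i|,$$ and for $\alpha=0$ at the separable state $\sigma=|u_1\rangle\langle u_1|\otimes|v_1\rangle\langle v_1|$. -/

import Mathlib

open scoped NNReal ENNReal ComplexOrder Matrix Kronecker

noncomputable section

namespace RenyiEnt

variable {m n : Type*} [Fintype m] [Fintype n] [DecidableEq m] [DecidableEq n]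

/-! ### States, supports and functions of operators

Operators on a Hilbert space with orthonormal basis indexed by a finite type `k` are matrices
`Matrix k k ℂ`, and the tensor product of the spaces with bases `m` and `n` has basis `m × n`.
All logarithms are to base two. -/

/-- Density operators (states). -/
def IsDensity {k : Type*} [Fintype k] (ρ : Matrix k k ℂ) : Prop :=
  ρ.PosSemidef ∧ ρ.trace = 1

/-- The rank-one operator `|ψ⟩⟨ψ|`. -/
def pureState {k : Type*} (ψ : EuclideanSpace ℂ k) : Matrix k k ℂ :=
  Matrix.of fun i j => ψ i * star (ψ j)

/-- The support of a Hermitian operator, which is its range. -/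
def supp {k : Type*} [Fintype k] (A : Matrix k k ℂ) : Submodule ℂ (k → ℂ) :=
  LinearMap.range A.mulVecLin

/-- The power `A ^ s` of a positive semidefinite operator, taken on the support of `A`
and zero on the kernel (so `A ^ 0` is the projection onto the support). -/
def powSupp {k : Type*} [Fintype k] [DecidableEq k] (A : Matrix k k ℂ) (s : ℝ) : Matrix k k ℂ :=
  cfc (fun x : ℝ => if x = 0 then 0 else x ^ s) A

/-- The binary logarithm of a positive semidefinite operator, taken on the support of `A`
and zero on the kernel (as `Real.logb 2 0 = 0`). -/
def logSupp {k : Type*} [Fintype k] [DecidableEq k] (A : Matrix k k ℂ) : Matrix k k ℂ :=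
  cfc (fun x : ℝ => Real.logb 2 x) A

/-- The binary logarithm of a nonnegative real, with `log 0 = -∞`. -/
def elog (x : ℝ) : EReal :=
  if x ≤ 0 then ⊥ else (Real.logb 2 x : EReal)

open scoped Classical in
/-- The Rényi relative entropy `S_α(ρ‖σ)` of order `α ∈ [0, ∞)`. For `α < 1` and
`Tr (ρ ^ α σ ^ (1 - α)) = 0` the value is `(negative) * (-∞) = +∞`. -/
def renyiRelEntropy {k : Type*} [Fintype k] [DecidableEq k] (α : ℝ≥0)
    (ρ σ : Matrix k k ℂ) : EReal :=
  if α = 1 then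
    if supp ρ ≤ supp σ then (((ρ * (logSupp ρ - logSupp σ)).trace.re : ℝ) : EReal) else ⊤
  else if supp ρ ≤ supp σ ∨ α < 1 then
    ((1 / ((α : ℝ) - 1) : ℝ) : EReal) *
      elog (powSupp ρ (α : ℝ) * powSupp σ (1 - (α : ℝ))).trace.re
  else ⊤

/-! ### Separable states and the relative entropy of entanglement -/

/-- `σ` is a finite sum of tensor products of positive semidefinite operators. -/
def IsSeparable (σ : Matrix (m × n) (m × n) ℂ) : Prop :=
  ∃ (N : ℕ) (τ : Fin N → Matrix m m ℂ) (ω : Fin N → Matrix n n ℂ),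
    (∀ i, (τ i).PosSemidef) ∧ (∀ i, (ω i).PosSemidef) ∧ σ = ∑ i, τ i ⊗ₖ ω i

/-- The set of separable density operators. -/
def SepStates (m n : Type*) [Fintype m] [Fintype n] [DecidableEq m] [DecidableEq n] :
    Set (Matrix (m × n) (m × n) ℂ) :=
  {σ | IsSeparable σ ∧ IsDensity σ}

/-- The Rényi `α`-relative entropy of entanglement `E_{R,α}(ρ)`. -/
def relEntanglement (α : ℝ≥0) (ρ : Matrix (m × n) (m × n) ℂ) : EReal :=
  ⨅ σ ∈ SepStates m n, renyiRelEntropy α ρ σ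

/-- `σ` is a separable state that attains the infimum defining `E_{R,α}(ρ)`. -/
def IsOptimal (α : ℝ≥0) (ρ σ : Matrix (m × n) (m × n) ℂ) : Prop :=
  σ ∈ SepStates m n ∧ renyiRelEntropy α ρ σ = relEntanglement α ρ

/-! ### Schmidt coefficients and the Rényi entropy of entanglement -/

/-- The Rényi entropy `H_α(p)` of order `α ∈ [0, ∞]` of a finite probability vector. -/
def renyiEntropy {ι : Type*} [Fintype ι] (α : ℝ≥0∞) (p : ι → ℝ) : ℝ :=
  if α = ⊤ then -Real.logb 2 (⨆ i, p i)
  else if α = 0 then Real.logb 2 (Set.ncard {i | p i ≠ 0})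
  else if α = 1 then -∑ i, p i * Real.logb 2 (p i)
  else 1 / (1 - α.toReal) * Real.logb 2 (∑ i, p i ^ α.toReal)

/-- The coefficient matrix of a vector of the tensor product. -/
def coeffMatrix (ψ : EuclideanSpace ℂ (m × n)) : Matrix m n ℂ :=
  Matrix.of fun i j => ψ (i, j)

/-- The Schmidt coefficients of `ψ` in decreasing order, padded with zeros: the eigenvalues of
the reduced operator `M Mᴴ = Tr_B |ψ⟩⟨ψ|`, i.e. the squared singular values of the coefficient
matrix `M` of `ψ`. -/
def schmidtCoeff (ψ : EuclideanSpace ℂ (m × n)) : Fin (Fintype.card m) → ℝ :=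
  (Matrix.isHermitian_mul_conjTranspose_self (coeffMatrix ψ)).eigenvalues₀

/-- The Rényi entropy of entanglement `E_α(ψ)` of order `α ∈ [0, ∞]`. -/
def renyiEntanglement (α : ℝ≥0∞) (ψ : EuclideanSpace ℂ (m × n)) : ℝ :=
  renyiEntropy α (schmidtCoeff ψ)

/-- The product vector `u ⊗ v`. -/
def prodVec (u : EuclideanSpace ℂ m) (v : EuclideanSpace ℂ n) : EuclideanSpace ℂ (m × n) :=
  WithLp.toLp 2 fun p => u p.1 * v p.2

/-- `ψ = ∑ i, √(l i) u_i ⊗ v_i` is a Schmidt decomposition of `ψ`, with Schmidt coefficients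
`l 0 ≥ l 1 ≥ …` (zeros allowed). -/
structure IsSchmidtDecomposition (ψ : EuclideanSpace ℂ (m × n)) {d : ℕ} (l : Fin d → ℝ)
    (u : Fin d → EuclideanSpace ℂ m) (v : Fin d → EuclideanSpace ℂ n) : Prop where
  nonneg : ∀ i, 0 ≤ l i
  decreasing : Antitone l
  orthonormal_left : Orthonormal ℂ u
  orthonormal_right : Orthonormal ℂ v
  expansion : ψ = ∑ i, (Real.sqrt (l i) : ℂ) • prodVec (u i) (v i)

/-- The state diagonal in the Schmidt basis with weights proportional to `l i ^ (1 / α)`. -/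
def schmidtDiagState (α : ℝ≥0) {d : ℕ} (l : Fin d → ℝ)
    (u : Fin d → EuclideanSpace ℂ m) (v : Fin d → EuclideanSpace ℂ n) :
    Matrix (m × n) (m × n) ℂ :=
  ∑ i, ((l i ^ (1 / (α : ℝ)) / ∑ j, l j ^ (1 / (α : ℝ)) : ℝ) : ℂ) •
    pureState (prodVec (u i) (v i))

end RenyiEnt

end

noncomputable section

namespace RenyiEnt

/-! Write `ψ = ∑ √λ_i x_i` with `x_i = u_i ⊗ v_i`. By Cauchy–Schwarz and Bessel, every separable
state `σ` satisfies `⟨χ|σ|χ⟩ ≤ 1` whenever `χ = ∑ a_i x_i` with `|a_i| ≤ 1`. This is the only use of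
separability. For `α = 0` a rescaling gives `⟨ψ|σ|ψ⟩ ≤ max λ`, the required bound.

For the other orders, interpolate. Given a probability vector `q > 0`, put `χ_s = ∑ q_i^((1-s)/2)
x_i`. At `s = 0` this is a unit vector, and at `s = 1` its coefficients have modulus one, so the
three lines theorem yields `⟨χ_s|σ^s|χ_s⟩ ≤ 1` for `0 ≤ s ≤ 1` (`sum_rpowSupp_mul_sq_le_one`). Let
`q_i = λ_i^(1/α) / Z` with `Z = ∑ λ_j^(1/α)`. For `0 < α ≤ 1` take `s = 1 - α`: then `χ_s` is a
multiple of `ψ`, and `⟨ψ|σ^(1-α)|ψ⟩ ≤ Z^α`. For `1 ≤ α ≤ 2` take `s = α - 1`: Cauchy–Schwarz for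
`⟨χ_s|ψ⟩ = Z^(α/2)` against `σ^(α-1)` and `σ^(1-α)` gives `⟨ψ|σ^(1-α)|ψ⟩ ≥ Z^α`. For `α = 1`
differentiate the inequality at `s = 0`, where equality holds when `ψ` lies in the support of `σ`.

Conversely, a state diagonal in the `x_i` reduces the relative entropy to a classical sum, which the
stated weights make equal to the bound. Zero Schmidt coefficients are discarded beforehand. -/

/-- The function `x ↦ x ^ s` with value `0` at `0`. -/
def rpowSupp (s x : ℝ) : ℝ := if x = 0 then 0 else x ^ s

lemma rpowSupp_nonneg {s x : ℝ} (hx : 0 ≤ x) : 0 ≤ rpowSupp s x := by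
  unfold rpowSupp; split_ifs <;> positivity

/-! ### Three lines interpolation for quadratic forms of `σ^s` -/

section Interpolation

variable {K ι : Type*} [Fintype K] [Fintype ι]

/-- The holomorphic interpolating function of the three lines argument. -/
def interpFun (μ : K → ℝ) (c : K → ι → ℂ) (q : ι → ℝ) (z : ℂ) : ℂ :=
  ∑ k, (if μ k = 0 then 0 else (μ k : ℂ) ^ z) *
    ((∑ i, (q i : ℂ) ^ ((1 - z) / 2) * c k i) * ∑ i, (q i : ℂ) ^ ((1 - z) / 2) * star (c k i))

lemma differentiable_interpFun (μ : K → ℝ) (c : K → ι → ℂ) {q : ι → ℝ} (hq : ∀ i, 0 < q i) :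
    Differentiable ℂ (interpFun μ c q) := by
  have hqd : ∀ i, Differentiable ℂ fun z : ℂ => (q i : ℂ) ^ ((1 - z) / 2) := fun i =>
    Differentiable.const_cpow (by fun_prop) (Or.inl (by exact_mod_cast (hq i).ne'))
  refine Differentiable.fun_sum fun k _ => Differentiable.fun_mul ?_ (Differentiable.fun_mul ?_ ?_)
  · by_cases hk : μ k = 0
    · simp [hk]
    · simp only [hk, if_false]
      exact Differentiable.const_cpow differentiable_id (Or.inl (by exact_mod_cast hk))
  · exact Differentiable.fun_sum fun i _ => (hqd i).mul_const _
  · exact Differentiable.fun_sum fun i _ => (hqd i).mul_const _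

/-- Conjugating `c` but not the powers of `q` keeps the function holomorphic. The price is a product
of two different sums; `2xy ≤ x² + y²` splits it into two quadratic forms with conjugate
coefficients, each bounded separately. -/
lemma norm_interpFun_le {μ : K → ℝ} (hμ : ∀ k, 0 ≤ μ k) (c : K → ι → ℂ) (q : ι → ℝ) (z : ℂ) :
    ‖interpFun μ c q z‖ ≤
      ((∑ k, rpowSupp z.re (μ k) * ‖∑ i, (q i : ℂ) ^ ((1 - z) / 2) * c k i‖ ^ 2) +
        ∑ k, rpowSupp z.re (μ k) * ‖∑ i, star ((q i : ℂ) ^ ((1 - z) / 2)) * c k i‖ ^ 2) / 2 := by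
  rw [← Finset.sum_add_distrib, Finset.sum_div]
  refine (norm_sum_le _ _).trans (Finset.sum_le_sum fun k _ => ?_)
  have h1 : ‖(if μ k = 0 then 0 else (μ k : ℂ) ^ z)‖ = rpowSupp z.re (μ k) := by
    unfold rpowSupp
    split_ifs with h
    · simp
    · exact Complex.norm_cpow_eq_rpow_re_of_pos ((hμ k).lt_of_ne' h) z
  have h2 : ‖∑ i, (q i : ℂ) ^ ((1 - z) / 2) * star (c k i)‖
      = ‖∑ i, star ((q i : ℂ) ^ ((1 - z) / 2)) * c k i‖ := by
    rw [← norm_star]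
    simp [mul_comm]
  rw [norm_mul, norm_mul, h1, h2]
  have h3 := rpowSupp_nonneg (s := z.re) (hμ k)
  nlinarith [mul_nonneg h3 (sq_nonneg (‖∑ i, (q i : ℂ) ^ ((1 - z) / 2) * c k i‖
    - ‖∑ i, star ((q i : ℂ) ^ ((1 - z) / 2)) * c k i‖))]

/-- A Hölder type inequality interpolating between an isometry bound at `s = 0` and a bound on
vectors with coefficients in the unit disc at `s = 1`. -/
theorem sum_rpowSupp_mul_sq_le_one {μ : K → ℝ} (hμ : ∀ k, 0 ≤ μ k) {c : K → ι → ℂ}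
    (h0 : ∀ a : ι → ℂ, ∑ k, ‖∑ i, a i * c k i‖ ^ 2 ≤ ∑ i, ‖a i‖ ^ 2)
    (h1 : ∀ a : ι → ℂ, (∀ i, ‖a i‖ ≤ 1) → ∑ k, μ k * ‖∑ i, a i * c k i‖ ^ 2 ≤ 1)
    {q : ι → ℝ} (hq : ∀ i, 0 < q i) (hq1 : ∑ i, q i = 1) {s : ℝ} (hs0 : 0 ≤ s) (hs1 : s ≤ 1) :
    ∑ k, rpowSupp s (μ k) * ‖∑ i, ((q i ^ ((1 - s) / 2) : ℝ) : ℂ) * c k i‖ ^ 2 ≤ 1 := by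
  have hq_le : ∀ i, q i ≤ 1 := fun i =>
    hq1 ▸ Finset.single_le_sum (fun j _ => (hq j).le) (Finset.mem_univ i)
  have hnorm : ∀ (z : ℂ) i, ‖(q i : ℂ) ^ ((1 - z) / 2)‖ = q i ^ ((1 - z.re) / 2) := fun z i => by
    rw [Complex.norm_cpow_eq_rpow_re_of_pos (hq i)]
    congr 1
    simp
  -- On this line the coefficients satisfy `|a_i|² = q_i`, and the powers of `μ k` have modulus at
  -- most one, so the isometry bound gives `∑ q_i = 1`.
  have hre0 : ∀ z : ℂ, z.re = 0 → ‖interpFun μ c q z‖ ≤ 1 := by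
    intro z hz
    have key : ∀ a : ι → ℂ, (∀ i, ‖a i‖ = q i ^ ((1 : ℝ) / 2)) →
        ∑ k, rpowSupp z.re (μ k) * ‖∑ i, a i * c k i‖ ^ 2 ≤ 1 := by
      intro a ha
      calc ∑ k, rpowSupp z.re (μ k) * ‖∑ i, a i * c k i‖ ^ 2
          ≤ ∑ k, ‖∑ i, a i * c k i‖ ^ 2 := by
            refine Finset.sum_le_sum fun k _ => mul_le_of_le_one_left (sq_nonneg _) ?_
            unfold rpowSupp
            split_ifs <;> simp [hz]
        _ ≤ ∑ i, ‖a i‖ ^ 2 := h0 a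
        _ = 1 := by
            rw [← hq1]
            refine Finset.sum_congr rfl fun i _ => ?_
            rw [ha, ← Real.sqrt_eq_rpow, Real.sq_sqrt (hq i).le]
    have e1 := key (fun i => (q i : ℂ) ^ ((1 - z) / 2)) (fun i => by rw [hnorm, hz, sub_zero])
    have e2 := key (fun i => star ((q i : ℂ) ^ ((1 - z) / 2)))
      (fun i => by rw [norm_star, hnorm, hz, sub_zero])
    linarith [norm_interpFun_le hμ c q z]
  -- Here the exponent `(1 - z) / 2` is purely imaginary, so the coefficients are unimodular.
  have hre1 : ∀ z : ℂ, z.re = 1 → ‖interpFun μ c q z‖ ≤ 1 := by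
    intro z hz
    have key : ∀ a : ι → ℂ, (∀ i, ‖a i‖ ≤ 1) →
        ∑ k, rpowSupp z.re (μ k) * ‖∑ i, a i * c k i‖ ^ 2 ≤ 1 := by
      intro a ha
      refine le_trans (Finset.sum_le_sum fun k _ => ?_) (h1 a ha)
      refine mul_le_mul_of_nonneg_right ?_ (sq_nonneg _)
      unfold rpowSupp
      split_ifs with h <;> simp [hz, hμ k]
    have e1 := key (fun i => (q i : ℂ) ^ ((1 - z) / 2)) (fun i => by simp [hnorm, hz])
    have e2 := key (fun i => star ((q i : ℂ) ^ ((1 - z) / 2)))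
      (fun i => by rw [norm_star, hnorm, hz]; simp)
    linarith [norm_interpFun_le hμ c q z]
  -- Any finite bound on the strip is enough; this one comes from `x^t ≤ 1 + x` for `0 ≤ t ≤ 1`.
  have hbdd : BddAbove ((norm ∘ interpFun μ c q) ''
      Complex.HadamardThreeLines.verticalClosedStrip 0 1) := by
    refine ⟨Fintype.card ι + 1, ?_⟩
    rintro _ ⟨z, ⟨hz0, hz1⟩, rfl⟩
    have key : ∀ a : ι → ℂ, (∀ i, ‖a i‖ ≤ 1) →
        ∑ k, rpowSupp z.re (μ k) * ‖∑ i, a i * c k i‖ ^ 2 ≤ Fintype.card ι + 1 := by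
      intro a ha
      calc ∑ k, rpowSupp z.re (μ k) * ‖∑ i, a i * c k i‖ ^ 2
          ≤ ∑ k, (1 + μ k) * ‖∑ i, a i * c k i‖ ^ 2 := by
            refine Finset.sum_le_sum fun k _ => mul_le_mul_of_nonneg_right ?_ (sq_nonneg _)
            unfold rpowSupp
            split_ifs with h
            · linarith [hμ k]
            · rcases le_total (μ k) 1 with hk | hk
              · linarith [Real.rpow_le_one (hμ k) hk hz0, hμ k]
              · have := Real.rpow_le_rpow_of_exponent_le hk hz1
                rw [Real.rpow_one] at this
                linarith
        _ = ∑ k, ‖∑ i, a i * c k i‖ ^ 2 + ∑ k, μ k * ‖∑ i, a i * c k i‖ ^ 2 := by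
            rw [← Finset.sum_add_distrib]
            exact Finset.sum_congr rfl fun k _ => by ring
        _ ≤ Fintype.card ι + 1 := by
            refine add_le_add ((h0 a).trans ?_) (h1 a ha)
            calc ∑ i, ‖a i‖ ^ 2 ≤ ∑ _i : ι, (1 : ℝ) :=
                  Finset.sum_le_sum fun i _ => pow_le_one₀ (norm_nonneg _) (ha i)
              _ = Fintype.card ι := by simp
    have hn : ∀ i, ‖(q i : ℂ) ^ ((1 - z) / 2)‖ ≤ 1 := fun i => by
      rw [hnorm]
      exact Real.rpow_le_one (hq i).le (hq_le i) (by linarith)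
    have e1 := key _ hn
    have e2 := key (fun i => star ((q i : ℂ) ^ ((1 - z) / 2))) (fun i => by
      rw [norm_star]; exact hn i)
    have := norm_interpFun_le hμ c q z
    simp only [Function.comp_apply]
    linarith
  have hF := Complex.HadamardThreeLines.norm_le_interp_of_mem_verticalClosedStrip₀₁'
    (interpFun μ c q) (z := (s : ℂ)) (a := 1) (b := 1) ⟨by simpa using hs0, by simpa using hs1⟩
    (differentiable_interpFun μ c hq).diffContOnCl hbdd (fun z hz => hre0 z hz)
    (fun z hz => hre1 z hz)
  simp only [Real.one_rpow, mul_one] at hF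
  -- At a real point the two sums are complex conjugates, so the holomorphic function takes the
  -- value of the quadratic form.
  have hval : interpFun μ c q s = ((∑ k, rpowSupp s (μ k) *
      ‖∑ i, ((q i ^ ((1 - s) / 2) : ℝ) : ℂ) * c k i‖ ^ 2 : ℝ) : ℂ) := by
    unfold interpFun
    rw [Complex.ofReal_sum]
    refine Finset.sum_congr rfl fun k _ => ?_
    have hc : ∀ i, (q i : ℂ) ^ ((1 - (s : ℂ)) / 2) = ((q i ^ ((1 - s) / 2) : ℝ) : ℂ) := fun i => by
      rw [Complex.ofReal_cpow (hq i).le]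
      push_cast
      rfl
    simp only [hc]
    rw [Complex.ofReal_mul]
    congr 1
    · unfold rpowSupp
      split_ifs with h
      · simp
      · rw [Complex.ofReal_cpow (hμ k)]
    · rw [Complex.ofReal_pow, ← Complex.mul_conj']
      congr 1
      simp
  rw [hval, Complex.norm_real] at hF
  exact (le_abs_self _).trans hF

end Interpolation

/-! ### Bounds on `⟨ψ|σ^(1-α)|ψ⟩` and `⟨ψ|log σ|ψ⟩` -/

section Bounds

variable {K ι : Type*} [Fintype K] [Fintype ι]

/-- Columns of `c` are orthonormal. -/
def IsIsometric (c : K → ι → ℂ) : Prop :=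
  ∀ a b : ι → ℂ, ∑ k, star (∑ i, a i * c k i) * ∑ i, b i * c k i = ∑ i, star (a i) * b i

lemma IsIsometric.sum_norm_sq {c : K → ι → ℂ} (hc : IsIsometric c) (a : ι → ℂ) :
    ∑ k, ‖∑ i, a i * c k i‖ ^ 2 = ∑ i, ‖a i‖ ^ 2 := by
  have h := hc a a
  simp only [Complex.star_def, Complex.conj_mul'] at h
  exact_mod_cast h

/-- The components `∑ i, √(l i) c k i` of the vector with Schmidt coefficients `l`. -/
def amplitude (l : ι → ℝ) (c : K → ι → ℂ) (k : K) : ℂ := ∑ i, (Real.sqrt (l i) : ℂ) * c k i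

lemma IsIsometric.sum_norm_amplitude_sq {c : K → ι → ℂ} (hc : IsIsometric c) {l : ι → ℝ}
    (hl : ∀ i, 0 ≤ l i) : ∑ k, ‖amplitude l c k‖ ^ 2 = ∑ i, l i := by
  unfold amplitude
  rw [hc.sum_norm_sq]
  refine Finset.sum_congr rfl fun i _ => ?_
  rw [Complex.norm_real, Real.norm_eq_abs, sq_abs, Real.sq_sqrt (hl i)]

variable {μ : K → ℝ} (hμ : ∀ k, 0 ≤ μ k) {c : K → ι → ℂ} (hc : IsIsometric c)
  (h1 : ∀ a : ι → ℂ, (∀ i, ‖a i‖ ≤ 1) → ∑ k, μ k * ‖∑ i, a i * c k i‖ ^ 2 ≤ 1)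
  {l : ι → ℝ} (hl : ∀ i, 0 < l i)

include hμ hc h1 hl

/-- The upper bound on `⟨ψ|σ^(1-α)|ψ⟩` for `0 < α ≤ 1`. -/
theorem sum_rpowSupp_mul_amplitude_le [Nonempty ι] {α : ℝ} (hα0 : 0 < α) (hα1 : α ≤ 1) :
    ∑ k, rpowSupp (1 - α) (μ k) * ‖amplitude l c k‖ ^ 2 ≤ (∑ i, l i ^ (1 / α)) ^ α := by
  set Z := ∑ i, l i ^ (1 / α) with hZ
  have hZpos : 0 < Z := Finset.sum_pos (fun i _ => Real.rpow_pos_of_pos (hl i) _)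
    Finset.univ_nonempty
  have key := sum_rpowSupp_mul_sq_le_one hμ (fun a => (hc.sum_norm_sq a).le) h1
    (q := fun i => l i ^ (1 / α) / Z) (fun i => div_pos (Real.rpow_pos_of_pos (hl i) _) hZpos)
    (by rw [← Finset.sum_div, ← hZ, div_self hZpos.ne']) (s := 1 - α) (by linarith) (by linarith)
  -- This choice of `q` makes the interpolated vector proportional to `ψ`.
  have hq : ∀ i, (l i ^ (1 / α) / Z) ^ ((1 - (1 - α)) / 2) = Z ^ (-(α / 2)) * Real.sqrt (l i) := by
    intro i
    rw [Real.div_rpow (Real.rpow_nonneg (hl i).le _) hZpos.le, ← Real.rpow_mul (hl i).le,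
      Real.sqrt_eq_rpow, Real.rpow_neg hZpos.le, sub_sub_cancel, div_eq_inv_mul]
    congr 2
    field_simp
  have hw : ∀ k, ∑ i, (((l i ^ (1 / α) / Z) ^ ((1 - (1 - α)) / 2) : ℝ) : ℂ) * c k i
      = ((Z ^ (-(α / 2)) : ℝ) : ℂ) * amplitude l c k := by
    intro k
    rw [amplitude, Finset.mul_sum]
    refine Finset.sum_congr rfl fun i _ => ?_
    rw [hq]
    push_cast
    ring
  have hZ2 : (Z ^ (-(α / 2))) ^ 2 = (Z ^ α)⁻¹ := by
    rw [← Real.rpow_natCast, ← Real.rpow_mul hZpos.le, ← Real.rpow_neg hZpos.le]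
    congr 1
    push_cast
    ring
  simp only [hw, norm_mul, Complex.norm_real, mul_pow, Real.norm_eq_abs, sq_abs, hZ2] at key
  have hre : ∑ k, rpowSupp (1 - α) (μ k) * ((Z ^ α)⁻¹ * ‖amplitude l c k‖ ^ 2)
      = (Z ^ α)⁻¹ * ∑ k, rpowSupp (1 - α) (μ k) * ‖amplitude l c k‖ ^ 2 := by
    rw [Finset.mul_sum]
    exact Finset.sum_congr rfl fun k _ => by ring
  rw [hre, inv_mul_le_iff₀ (Real.rpow_pos_of_pos hZpos _), mul_one] at key
  exact key

/-- The lower bound on `⟨ψ|σ^(1-α)|ψ⟩` for `1 ≤ α ≤ 2`. -/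
theorem le_sum_rpowSupp_mul_amplitude [Nonempty ι] {α : ℝ} (hα1 : 1 ≤ α) (hα2 : α ≤ 2)
    (hsupp : ∀ k, μ k = 0 → amplitude l c k = 0) :
    (∑ i, l i ^ (1 / α)) ^ α ≤ ∑ k, rpowSupp (1 - α) (μ k) * ‖amplitude l c k‖ ^ 2 := by
  set Z := ∑ i, l i ^ (1 / α) with hZ
  have hZpos : 0 < Z := Finset.sum_pos (fun i _ => Real.rpow_pos_of_pos (hl i) _)
    Finset.univ_nonempty
  have hqpos : ∀ i, 0 < l i ^ (1 / α) / Z := fun i =>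
    div_pos (Real.rpow_pos_of_pos (hl i) _) hZpos
  have hqsum : ∑ i, l i ^ (1 / α) / Z = 1 := by rw [← Finset.sum_div, ← hZ, div_self hZpos.ne']
  -- The exponent `s = α - 1` must lie in `[0, 1]`, which is where `α ≤ 2` enters.
  have key := sum_rpowSupp_mul_sq_le_one hμ (fun a => (hc.sum_norm_sq a).le) h1
    (q := fun i => l i ^ (1 / α) / Z) hqpos hqsum (s := α - 1) (by linarith) (by linarith)
  set χ : ι → ℝ := fun i => (l i ^ (1 / α) / Z) ^ ((1 - (α - 1)) / 2) with hχ
  -- Since `√l_i = Z^(α/2) q_i^(α/2)` and `χ_i = q_i^(1-α/2)`, each term is `Z^(α/2) q_i`.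
  have hoverlap : ∑ i, χ i * Real.sqrt (l i) = Z ^ (α / 2) := by
    rw [← mul_one (Z ^ (α / 2)), ← hqsum, Finset.mul_sum]
    refine Finset.sum_congr rfl fun i _ => ?_
    have hs : Real.sqrt (l i) = Z ^ (α / 2) * (l i ^ (1 / α) / Z) ^ (α / 2) := by
      rw [← Real.mul_rpow hZpos.le (hqpos i).le, mul_div_cancel₀ _ hZpos.ne',
        ← Real.rpow_mul (hl i).le, Real.sqrt_eq_rpow]
      congr 1
      field_simp
    rw [hs, hχ, mul_left_comm, ← Real.rpow_add (hqpos i)]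
    congr 1
    rw [← Real.rpow_one (l i ^ (1 / α) / Z), ← Real.rpow_mul (hqpos i).le]
    congr 1
    ring
  -- Insert `μ^((α-1)/2) μ^((1-α)/2) = 1` into `⟨χ|ψ⟩`; where `μ k = 0` the amplitude vanishes by
  -- the support condition.
  have hle : Z ^ (α / 2) ≤ ∑ k, (Real.sqrt (rpowSupp (α - 1) (μ k)) * ‖∑ i, (χ i : ℂ) * c k i‖) *
      (Real.sqrt (rpowSupp (1 - α) (μ k)) * ‖amplitude l c k‖) := by
    have h := congrArg norm (hc (fun i => (χ i : ℂ)) fun i => (Real.sqrt (l i) : ℂ))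
    have hr : ∑ i, star (χ i : ℂ) * (Real.sqrt (l i) : ℂ) = ((Z ^ (α / 2) : ℝ) : ℂ) := by
      rw [← hoverlap]
      push_cast
      simp
    rw [hr, Complex.norm_real, Real.norm_of_nonneg (Real.rpow_nonneg hZpos.le _)] at h
    rw [← h]
    refine (norm_sum_le _ _).trans (Finset.sum_le_sum fun k _ => ?_)
    rw [norm_mul, norm_star]
    change _ * ‖amplitude l c k‖ ≤ _
    by_cases hk : μ k = 0
    · simp [hsupp k hk]
    · have hp := (hμ k).lt_of_ne' hk
      have : Real.sqrt (rpowSupp (α - 1) (μ k)) * Real.sqrt (rpowSupp (1 - α) (μ k)) = 1 := by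
        rw [← Real.sqrt_mul (rpowSupp_nonneg (hμ k))]
        simp only [rpowSupp, hk, if_false]
        rw [← Real.rpow_add hp]
        simp
      refine le_of_eq ?_
      rw [mul_mul_mul_comm, this, one_mul]
  have hcs := Finset.sum_mul_sq_le_sq_mul_sq Finset.univ
    (fun k => Real.sqrt (rpowSupp (α - 1) (μ k)) * ‖∑ i, (χ i : ℂ) * c k i‖)
    (fun k => Real.sqrt (rpowSupp (1 - α) (μ k)) * ‖amplitude l c k‖)
  simp only [mul_pow, Real.sq_sqrt (rpowSupp_nonneg (hμ _))] at hcs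
  have hnn : 0 ≤ ∑ k, rpowSupp (1 - α) (μ k) * ‖amplitude l c k‖ ^ 2 :=
    Finset.sum_nonneg fun k _ => mul_nonneg (rpowSupp_nonneg (hμ k)) (sq_nonneg _)
  calc Z ^ α = (Z ^ (α / 2)) ^ 2 := by
        rw [← Real.rpow_natCast, ← Real.rpow_mul hZpos.le]
        congr 1
        push_cast
        ring
    _ ≤ _ := pow_le_pow_left₀ (Real.rpow_nonneg hZpos.le _) hle 2
    _ ≤ _ := hcs
    _ ≤ _ := mul_le_of_le_one_left hnn key

/-- The upper bound on `⟨ψ|log σ|ψ⟩`. -/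
theorem sum_log_mul_amplitude_le (hl1 : ∑ i, l i = 1)
    (hsupp : ∀ k, μ k = 0 → amplitude l c k = 0) :
    ∑ k, Real.log (μ k) * ‖amplitude l c k‖ ^ 2 ≤ ∑ i, l i * Real.log (l i) := by
  set f : ℝ → ℝ := fun s => ∑ k, rpowSupp s (μ k) *
    ‖∑ i, ((l i ^ ((1 - s) / 2) : ℝ) : ℂ) * c k i‖ ^ 2 with hf
  have hl0 : ∀ i, l i ^ ((1 - (0 : ℝ)) / 2) = Real.sqrt (l i) := fun i => by
    rw [sub_zero, Real.sqrt_eq_rpow]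
  have hf0 : f 0 = 1 := by
    rw [← hl1, ← hc.sum_norm_amplitude_sq fun i => (hl i).le]
    refine Finset.sum_congr rfl fun k _ => ?_
    simp only [hl0]
    by_cases hk : μ k = 0
    · have := hsupp k hk
      rw [this]
      rw [amplitude] at this
      simp [this]
    · simp [rpowSupp, hk, amplitude]
  have hf1 : ∀ s, 0 ≤ s → s ≤ 1 → f s ≤ 1 := fun s h0 hs =>
    sum_rpowSupp_mul_sq_le_one hμ (fun a => (hc.sum_norm_sq a).le) h1 hl hl1 h0 hs
  -- The derivative of `l_i^((1-s)/2)` at `s = 0`.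
  set b : ι → ℝ := fun i => -(1 / 2) * Real.log (l i) * Real.sqrt (l i) with hb
  have hderiv : HasDerivAt f (∑ k, (Real.log (μ k) * ‖amplitude l c k‖ ^ 2 +
      2 * (star (amplitude l c k) * ∑ i, (b i : ℂ) * c k i).re)) 0 := by
    refine HasDerivAt.fun_sum fun k _ => ?_
    have hw : HasDerivAt (fun s : ℝ => ∑ i, ((l i ^ ((1 - s) / 2) : ℝ) : ℂ) * c k i)
        (∑ i, (b i : ℂ) * c k i) 0 := by
      refine HasDerivAt.fun_sum fun i _ => HasDerivAt.mul_const ?_ _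
      refine HasDerivAt.ofReal_comp ?_
      have h := (((hasDerivAt_id (0 : ℝ)).const_sub 1).div_const 2).const_rpow (hl i)
      simp only [id, hl0] at h
      convert h using 1
      rw [hb]
      ring
    have hw2 := hw.norm_sq
    simp only [hl0, Complex.inner] at hw2
    -- On the kernel the summand is identically zero in `s`, and the claimed derivative also
    -- vanishes because the amplitude does.
    by_cases hk : μ k = 0
    · simp only [rpowSupp, hk, if_true, zero_mul, hsupp k hk]
      simpa using hasDerivAt_const (0 : ℝ) (0 : ℝ)
    · have hp := (hμ k).lt_of_ne' hk
      have hpow : HasDerivAt (fun s : ℝ => rpowSupp s (μ k)) (Real.log (μ k)) 0 := by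
        simp only [rpowSupp, hk, if_false]
        have := (hasDerivAt_id (0 : ℝ)).const_rpow hp
        simpa using this
      have h := hpow.fun_mul hw2
      have h0 : rpowSupp 0 (μ k) = 1 := by simp [rpowSupp, hk]
      rw [h0, one_mul, mul_comm (∑ i, _)] at h
      simp only [hl0] at h
      exact h
  -- As `f 0 = 1` and `f ≤ 1` on `[0, 1]`, the right derivative at `0` is nonpositive.
  have hnonpos : (∑ k, (Real.log (μ k) * ‖amplitude l c k‖ ^ 2 +
      2 * (star (amplitude l c k) * ∑ i, (b i : ℂ) * c k i).re)) ≤ 0 := by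
    refine le_of_tendsto hderiv.tendsto_slope_zero_right ?_
    filter_upwards [Ioo_mem_nhdsGT (zero_lt_one' ℝ)] with t ht
    rw [zero_add, hf0, smul_eq_mul]
    exact mul_nonpos_of_nonneg_of_nonpos (inv_nonneg.2 ht.1.le)
      (by linarith [hf1 t ht.1.le ht.2.le])
  rw [Finset.sum_add_distrib, ← Finset.mul_sum, ← Complex.re_sum] at hnonpos
  -- By isometry the cross terms sum to an inner product in the Schmidt basis, `-(1/2) ∑ l_i log
  -- l_i`; the factor two then leaves `-∑ l_i log l_i`.
  have hover := hc (fun i => (Real.sqrt (l i) : ℂ)) fun i => (b i : ℂ)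
  change ∑ k, star (amplitude l c k) * _ = _ at hover
  have hr : ∑ i, star (Real.sqrt (l i) : ℂ) * (b i : ℂ)
      = ((-(1 / 2) * ∑ i, l i * Real.log (l i) : ℝ) : ℂ) := by
    rw [Finset.mul_sum, Complex.ofReal_sum]
    refine Finset.sum_congr rfl fun i _ => ?_
    rw [Complex.star_def, Complex.conj_ofReal, ← Complex.ofReal_mul, hb]
    congr 1
    have := Real.mul_self_sqrt (hl i).le
    linear_combination (-(1 / 2) * Real.log (l i)) * this
  rw [hover, hr, Complex.ofReal_re] at hnonpos
  linarith

end Bounds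

/-! ### Pure states and spectral expansions -/

section PureStates

lemma pureState_eq_vecMulVec {k : Type*} (φ : EuclideanSpace ℂ k) :
    pureState φ = Matrix.vecMulVec φ.ofLp (star φ.ofLp) := rfl

variable {k : Type*} [Fintype k] [DecidableEq k]

omit [DecidableEq k] in
lemma posSemidef_pureState (φ : EuclideanSpace ℂ k) : (pureState φ).PosSemidef := by
  rw [pureState_eq_vecMulVec]
  exact Matrix.posSemidef_vecMulVec_self_star _

omit [DecidableEq k] in
lemma pureState_mulVec (φ x : EuclideanSpace ℂ k) :
    pureState φ *ᵥ x.ofLp = inner ℂ φ x • φ.ofLp := by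
  rw [pureState_eq_vecMulVec, Matrix.vecMulVec_mulVec, EuclideanSpace.inner_eq_star_dotProduct,
    dotProduct_comm]
  ext i
  simp [mul_comm]

omit [DecidableEq k] in
lemma trace_pureState (φ : EuclideanSpace ℂ k) : (pureState φ).trace = (‖φ‖ ^ 2 : ℝ) := by
  rw [pureState_eq_vecMulVec, Matrix.trace_vecMulVec, ← EuclideanSpace.inner_eq_star_dotProduct,
    inner_self_eq_norm_sq_to_K]
  push_cast
  rfl

omit [DecidableEq k] in
lemma isIdempotentElem_pureState {φ : EuclideanSpace ℂ k} (hφ : ‖φ‖ = 1) :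
    IsIdempotentElem (pureState φ) := by
  unfold IsIdempotentElem
  have h : star φ.ofLp ⬝ᵥ φ.ofLp = 1 := by
    rw [dotProduct_comm, ← EuclideanSpace.inner_eq_star_dotProduct, inner_self_eq_norm_sq_to_K, hφ]
    simp
  rw [pureState_eq_vecMulVec, Matrix.vecMulVec_mul_vecMulVec, h, one_smul]

/-- A projection has spectrum in `{0, 1}`, so only the values at these two points matter. -/
lemma cfc_pureState_congr {φ : EuclideanSpace ℂ k} (hφ : ‖φ‖ = 1) {f g : ℝ → ℝ}
    (h0 : f 0 = g 0) (h1 : f 1 = g 1) : cfc f (pureState φ) = cfc g (pureState φ) := by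
  refine cfc_congr fun x hx => ?_
  rcases (isIdempotentElem_pureState hφ).spectrum_subset ℝ hx with rfl | hx
  · exact h0
  · rw [Set.mem_singleton_iff] at hx
    rw [hx, h1]

lemma powSupp_pureState {φ : EuclideanSpace ℂ k} (hφ : ‖φ‖ = 1) (s : ℝ) :
    powSupp (pureState φ) s = pureState φ := by
  unfold powSupp
  rw [cfc_pureState_congr hφ (g := id) (by simp) (by simp)]
  exact cfc_id ℝ _ (posSemidef_pureState φ).1

lemma logSupp_pureState {φ : EuclideanSpace ℂ k} (hφ : ‖φ‖ = 1) :
    logSupp (pureState φ) = 0 := by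
  unfold logSupp
  rw [cfc_pureState_congr hφ (g := fun _ => 0) (by simp) (by simp)]
  exact cfc_const_zero ℝ _

omit [DecidableEq k] in
lemma mem_supp_pureState {φ : EuclideanSpace ℂ k} (hφ : ‖φ‖ = 1) :
    φ.ofLp ∈ supp (pureState φ) := by
  refine ⟨φ.ofLp, ?_⟩
  rw [Matrix.mulVecLin_apply, pureState_mulVec, inner_self_eq_norm_sq_to_K, hφ]
  simp

omit [DecidableEq k] in
lemma supp_pureState_le {φ : EuclideanSpace ℂ k} {σ : Matrix k k ℂ} (h : φ.ofLp ∈ supp σ) :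
    supp (pureState φ) ≤ supp σ := by
  rintro _ ⟨x, rfl⟩
  rw [Matrix.mulVecLin_apply, ← WithLp.ofLp_toLp 2 x, pureState_mulVec]
  exact Submodule.smul_mem _ _ h

/-- Matrix elements of a function of a Hermitian operator in terms of its eigenvectors. -/
lemma trace_pureState_mul_cfc {σ : Matrix k k ℂ} (hσ : σ.IsHermitian) (f : ℝ → ℝ)
    (φ : EuclideanSpace ℂ k) : (pureState φ * cfc f σ).trace
      = ((∑ j, f (hσ.eigenvalues j) * ‖inner ℂ (hσ.eigenvectorBasis j) φ‖ ^ 2 : ℝ) : ℂ) := by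
  have hentry : cfc f σ = ∑ j, ((f (hσ.eigenvalues j) : ℝ) : ℂ) •
      pureState (hσ.eigenvectorBasis j) := by
    rw [hσ.cfc_eq, Matrix.IsHermitian.cfc, Unitary.conjStarAlgAut_apply]
    ext a b
    rw [Matrix.mul_apply, Matrix.sum_apply]
    refine Finset.sum_congr rfl fun j _ => ?_
    simp [Matrix.mul_diagonal, pureState, Matrix.star_apply]
    ring
  rw [hentry, Finset.mul_sum, Matrix.trace_sum, Complex.ofReal_sum]
  refine Finset.sum_congr rfl fun j _ => ?_
  rw [Matrix.mul_smul, Matrix.trace_smul, pureState_eq_vecMulVec, pureState_eq_vecMulVec,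
    Matrix.vecMulVec_mul_vecMulVec, Matrix.trace_vecMulVec, Complex.ofReal_mul, smul_eq_mul]
  congr 1
  rw [dotProduct_smul, smul_eq_mul, dotProduct_comm (star φ.ofLp),
    ← EuclideanSpace.inner_eq_star_dotProduct, ← EuclideanSpace.inner_eq_star_dotProduct,
    Complex.ofReal_pow, ← Complex.conj_mul', inner_conj_symm]

lemma trace_pureState_mul {σ : Matrix k k ℂ} (hσ : σ.IsHermitian) (φ : EuclideanSpace ℂ k) :
    (pureState φ * σ).trace.re
      = ∑ j, hσ.eigenvalues j * ‖inner ℂ (hσ.eigenvectorBasis j) φ‖ ^ 2 := by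
  have h := trace_pureState_mul_cfc hσ id φ
  have hid : cfc (id : ℝ → ℝ) σ = σ := cfc_id ℝ σ hσ
  rw [hid] at h
  rw [h, Complex.ofReal_re]
  rfl

lemma inner_eigenvectorBasis_mulVec {σ : Matrix k k ℂ} (hσ : σ.IsHermitian) (x : k → ℂ) (j : k) :
    inner ℂ (hσ.eigenvectorBasis j) (WithLp.toLp 2 (σ *ᵥ x))
      = (hσ.eigenvalues j : ℂ) * inner ℂ (hσ.eigenvectorBasis j) (WithLp.toLp 2 x) := by
  rw [EuclideanSpace.inner_eq_star_dotProduct, EuclideanSpace.inner_eq_star_dotProduct,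
    dotProduct_comm, dotProduct_comm x, Matrix.dotProduct_mulVec]
  have h : star (hσ.eigenvectorBasis j).ofLp ᵥ* σ
      = (hσ.eigenvalues j : ℂ) • star (hσ.eigenvectorBasis j).ofLp := by
    have := congrArg star (hσ.mulVec_eigenvectorBasis j)
    rw [Matrix.star_mulVec, hσ.eq] at this
    rw [this]
    ext i
    simp
  rw [h, smul_dotProduct, smul_eq_mul]

/-- The range of a Hermitian operator is orthogonal to its kernel. -/
lemma inner_eigenvectorBasis_eq_zero {σ : Matrix k k ℂ} (hσ : σ.IsHermitian)
    {φ : EuclideanSpace ℂ k} (hφ : φ.ofLp ∈ supp σ) {j : k} (hj : hσ.eigenvalues j = 0) :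
    inner ℂ (hσ.eigenvectorBasis j) φ = 0 := by
  obtain ⟨y, hy⟩ := hφ
  have h := inner_eigenvectorBasis_mulVec hσ y j
  rw [Matrix.mulVecLin_apply] at hy
  rw [hy, hj] at h
  simpa using h

/-- Rényi relative entropy of a pure state to a state, in an eigenbasis of the latter. -/
lemma renyiRelEntropy_pureState {α : ℝ≥0} (hα : α ≠ 1) {φ : EuclideanSpace ℂ k} (hφ : ‖φ‖ = 1)
    {σ : Matrix k k ℂ} (hσ : σ.IsHermitian) (h : supp (pureState φ) ≤ supp σ ∨ α < 1) :
    renyiRelEntropy α (pureState φ) σ = ((1 / ((α : ℝ) - 1) : ℝ) : EReal) *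
      elog (∑ j, rpowSupp (1 - α) (hσ.eigenvalues j) *
        ‖inner ℂ (hσ.eigenvectorBasis j) φ‖ ^ 2) := by
  rw [renyiRelEntropy, if_neg hα, if_pos h, powSupp_pureState hφ, powSupp,
    trace_pureState_mul_cfc hσ, Complex.ofReal_re]
  rfl

lemma renyiRelEntropy_one_pureState {φ : EuclideanSpace ℂ k} (hφ : ‖φ‖ = 1)
    {σ : Matrix k k ℂ} (hσ : σ.IsHermitian) (h : supp (pureState φ) ≤ supp σ) :
    renyiRelEntropy 1 (pureState φ) σ = ((-∑ j, Real.logb 2 (hσ.eigenvalues j) *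
        ‖inner ℂ (hσ.eigenvectorBasis j) φ‖ ^ 2 : ℝ) : EReal) := by
  rw [renyiRelEntropy, if_pos rfl, if_pos h, logSupp_pureState hφ, logSupp, zero_sub,
    Matrix.mul_neg, Matrix.trace_neg, trace_pureState_mul_cfc hσ, Complex.neg_re,
    Complex.ofReal_re]

end PureStates

/-! ### Product vectors and overlaps with separable states -/

section ProductVectors

lemma pureState_prodVec {m n : Type*} (u : EuclideanSpace ℂ m) (v : EuclideanSpace ℂ n) :
    pureState (prodVec u v) = pureState u ⊗ₖ pureState v := by
  ext ⟨i, j⟩ ⟨i', j'⟩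
  simp only [pureState, prodVec, Matrix.of_apply, Matrix.kroneckerMap_apply, star_mul']
  ring

variable {m n ι : Type*} [Fintype m] [Fintype n]

lemma inner_prodVec (u u' : EuclideanSpace ℂ m) (v v' : EuclideanSpace ℂ n) :
    inner ℂ (prodVec u v) (prodVec u' v') = inner ℂ u u' * inner ℂ v v' := by
  simp only [PiLp.inner_apply, prodVec, Finset.sum_mul_sum, ← Finset.univ_product_univ,
    Finset.sum_product]
  refine Finset.sum_congr rfl fun i _ => Finset.sum_congr rfl fun j _ => ?_
  simp
  ring

lemma orthonormal_prodVec {u : ι → EuclideanSpace ℂ m} {v : ι → EuclideanSpace ℂ n}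
    (hu : Orthonormal ℂ u) (hv : Orthonormal ℂ v) :
    Orthonormal ℂ fun i => prodVec (u i) (v i) := by
  classical
  rw [orthonormal_iff_ite] at hu hv ⊢
  intro i j
  rw [inner_prodVec, hu, hv]
  split_ifs <;> simp

variable [Fintype ι]

lemma isIsometric_inner {k : Type*} [Fintype k] (e : OrthonormalBasis k ℂ (EuclideanSpace ℂ (m × n)))
    {x : ι → EuclideanSpace ℂ (m × n)} (hx : Orthonormal ℂ x) :
    IsIsometric fun j i => inner ℂ (e j) (x i) := by
  intro a b
  have h : ∀ (a : ι → ℂ) j, ∑ i, a i * inner ℂ (e j) (x i) = inner ℂ (e j) (∑ i, a i • x i) := by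
    intro a j
    simp only [inner_sum, inner_smul_right]
  simp only [h, Complex.star_def, inner_conj_symm]
  rw [e.sum_inner_mul_inner, hx.inner_sum]

variable [DecidableEq m] [DecidableEq n]

-- Positive semidefinite factors are sums of rank-one operators, so it is enough to test product
-- vectors `x ⊗ y`. There `|∑ a_i ⟨x,u_i⟩⟨y,v_i⟩| ≤ C ‖x‖ ‖y‖` by Cauchy–Schwarz and Bessel in each
-- factor.
omit [DecidableEq m] [DecidableEq n] in
lemma re_trace_pureState_mul_kronecker_le {u : ι → EuclideanSpace ℂ m}
    {v : ι → EuclideanSpace ℂ n} (hu : Orthonormal ℂ u) (hv : Orthonormal ℂ v) {a : ι → ℂ} {C : ℝ}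
    (hC : 0 ≤ C) (ha : ∀ i, ‖a i‖ ≤ C) {τ : Matrix m m ℂ} {ω : Matrix n n ℂ} (hτ : τ.PosSemidef)
    (hω : ω.PosSemidef) : (pureState (∑ i, a i • prodVec (u i) (v i)) * τ ⊗ₖ ω).trace.re
      ≤ C ^ 2 * (τ ⊗ₖ ω).trace.re := by
  have hrank : ∀ (x : EuclideanSpace ℂ m) (y : EuclideanSpace ℂ n),
      (pureState (∑ i, a i • prodVec (u i) (v i)) * pureState (prodVec x y)).trace.re
        ≤ C ^ 2 * (pureState (prodVec x y)).trace.re := by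
    intro x y
    have hin : ‖inner ℂ (prodVec x y) (∑ i, a i • prodVec (u i) (v i))‖ ≤ C * (‖x‖ * ‖y‖) := by
      simp only [inner_sum, inner_smul_right, inner_prodVec]
      calc ‖∑ i, a i * (inner ℂ x (u i) * inner ℂ y (v i))‖
          ≤ ∑ i, C * (‖inner ℂ (u i) x‖ * ‖inner ℂ (v i) y‖) := by
            refine (norm_sum_le _ _).trans (Finset.sum_le_sum fun i _ => ?_)
            rw [norm_mul, norm_mul, norm_inner_symm x, norm_inner_symm y]
            gcongr
            exact ha i
        _ ≤ C * (‖x‖ * ‖y‖) := by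
            rw [← Finset.mul_sum]
            refine mul_le_mul_of_nonneg_left ?_ hC
            refine abs_le_of_sq_le_sq' ?_ (by positivity) |>.2
            rw [mul_pow]
            exact (Finset.sum_mul_sq_le_sq_mul_sq _ _ _).trans (mul_le_mul
              (hu.sum_inner_products_le x) (hv.sum_inner_products_le y)
              (Finset.sum_nonneg fun _ _ => sq_nonneg _) (sq_nonneg _))
    have hnorm : ‖prodVec x y‖ ^ 2 = ‖x‖ ^ 2 * ‖y‖ ^ 2 := by
      have h := inner_prodVec x x y y
      simp only [inner_self_eq_norm_sq_to_K] at h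
      exact_mod_cast h
    have htr : (pureState (∑ i, a i • prodVec (u i) (v i)) * pureState (prodVec x y)).trace.re
        = ‖inner ℂ (prodVec x y) (∑ i, a i • prodVec (u i) (v i))‖ ^ 2 := by
      rw [pureState_eq_vecMulVec, pureState_eq_vecMulVec, Matrix.vecMulVec_mul_vecMulVec,
        Matrix.trace_vecMulVec, dotProduct_smul, smul_eq_mul, dotProduct_comm (star _),
        ← EuclideanSpace.inner_eq_star_dotProduct, ← EuclideanSpace.inner_eq_star_dotProduct,
        ← inner_conj_symm, Complex.conj_mul', ← Complex.ofReal_pow, Complex.ofReal_re]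
    rw [htr, trace_pureState, Complex.ofReal_re, hnorm]
    calc _ ≤ (C * (‖x‖ * ‖y‖)) ^ 2 := pow_le_pow_left₀ (norm_nonneg _) hin 2
      _ = _ := by ring
  obtain ⟨N, x, hx⟩ := Matrix.posSemidef_iff_eq_sum_vecMulVec.1 hτ
  obtain ⟨N', y, hy⟩ := Matrix.posSemidef_iff_eq_sum_vecMulVec.1 hω
  have hdec : τ ⊗ₖ ω = ∑ r, ∑ s, pureState (prodVec (WithLp.toLp 2 (x r)) (WithLp.toLp 2 (y s))) := by
    simp only [pureState_prodVec]
    ext ⟨i, j⟩ ⟨i', j'⟩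
    simp only [hx, hy, Matrix.kroneckerMap_apply, Matrix.sum_apply, Finset.sum_mul_sum]
    rfl
  rw [hdec]
  simp only [Finset.mul_sum, Matrix.trace_sum, Complex.re_sum]
  exact Finset.sum_le_sum fun r _ => Finset.sum_le_sum fun s _ => hrank _ _

/-- The overlap of a separable state with a vector having a biorthogonal expansion with
coefficients of modulus at most `C`. -/
lemma re_trace_pureState_mul_le_of_mem_sepStates {u : ι → EuclideanSpace ℂ m}
    {v : ι → EuclideanSpace ℂ n} (hu : Orthonormal ℂ u) (hv : Orthonormal ℂ v) {a : ι → ℂ} {C : ℝ}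
    (hC : 0 ≤ C) (ha : ∀ i, ‖a i‖ ≤ C) {σ : Matrix (m × n) (m × n) ℂ} (hσ : σ ∈ SepStates m n) :
    (pureState (∑ i, a i • prodVec (u i) (v i)) * σ).trace.re ≤ C ^ 2 := by
  obtain ⟨⟨N, τ, ω, hτ, hω, hsum⟩, -, htr⟩ := hσ
  calc (pureState (∑ i, a i • prodVec (u i) (v i)) * σ).trace.re
      = ∑ r, (pureState (∑ i, a i • prodVec (u i) (v i)) * τ r ⊗ₖ ω r).trace.re := by
        rw [hsum, Finset.mul_sum, Matrix.trace_sum, Complex.re_sum]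
    _ ≤ ∑ r, C ^ 2 * (τ r ⊗ₖ ω r).trace.re := Finset.sum_le_sum fun r _ =>
        re_trace_pureState_mul_kronecker_le hu hv hC ha (hτ r) (hω r)
    _ = C ^ 2 := by
        rw [← Finset.mul_sum, ← Complex.re_sum, ← Matrix.trace_sum, ← hsum, htr, Complex.one_re,
          mul_one]

end ProductVectors

/-! ### Rényi entropies and extended logarithms -/

section Values

variable {ι : Type*} [Fintype ι]

lemma sum_subtype_ne_zero {E : Type*} [AddCommMonoid E] {l : ι → ℝ} {f : ι → E}
    (hf : ∀ i, l i = 0 → f i = 0) : ∑ i : {i // l i ≠ 0}, f i = ∑ i, f i := by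
  classical
  rw [← Finset.sum_subtype (p := fun i => l i ≠ 0) (Finset.univ.filter fun i => l i ≠ 0)
    (by simp) f]
  exact Finset.sum_filter_of_ne fun i _ h h' => h (hf i h')

/-- The optimal value of `Tr (ψ σ ^ (1 - α))` over separable states `σ`. -/
def optTrace (α : ℝ≥0) (l : ι → ℝ) : ℝ :=
  if α = 0 then ⨆ i, l i else (∑ i, l i ^ (1 / (α : ℝ))) ^ (α : ℝ)

lemma optTrace_pos [Nonempty ι] (α : ℝ≥0) {l : ι → ℝ} (hl : ∀ i, 0 < l i) : 0 < optTrace α l := by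
  unfold optTrace
  split_ifs with h
  · obtain ⟨i⟩ := ‹Nonempty ι›
    exact (hl i).trans_le (le_ciSup (Set.finite_range l).bddAbove i)
  · exact Real.rpow_pos_of_pos (Finset.sum_pos (fun i _ => Real.rpow_pos_of_pos (hl i) _)
      Finset.univ_nonempty) _

lemma renyiEntropy_inv_of_ne_one [Nonempty ι] {α : ℝ≥0} (hα : α ≠ 1) {l : ι → ℝ}
    (hl : ∀ i, 0 < l i) :
    renyiEntropy ((α : ℝ≥0∞)⁻¹) l = 1 / ((α : ℝ) - 1) * Real.logb 2 (optTrace α l) := by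
  unfold renyiEntropy optTrace
  by_cases h0 : α = 0
  · simp [h0]
  · have h1 : (α : ℝ≥0∞)⁻¹ ≠ 1 := by
      rw [ne_eq, ENNReal.inv_eq_one]
      exact_mod_cast hα
    have hα0 : (α : ℝ) ≠ 0 := by exact_mod_cast h0
    have hα1 : (α : ℝ) - 1 ≠ 0 := sub_ne_zero.2 (by exact_mod_cast hα)
    have hα1' : 1 - (α : ℝ)⁻¹ ≠ 0 := by
      rw [sub_ne_zero, ne_comm, ne_eq, inv_eq_one]
      exact_mod_cast hα
    have hpos : 0 < ∑ i, l i ^ (1 / (α : ℝ)) :=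
      Finset.sum_pos (fun i _ => Real.rpow_pos_of_pos (hl i) _) Finset.univ_nonempty
    rw [if_neg (by simpa using h0), if_neg (by simp), if_neg h1, if_neg h0,
      Real.logb_rpow_eq_mul_logb_of_pos hpos]
    simp only [ENNReal.toReal_inv, ENNReal.coe_toReal, one_div]
    rw [← mul_assoc]
    congr 1
    field_simp

lemma renyiEntropy_one (l : ι → ℝ) : renyiEntropy 1 l = -∑ i, l i * Real.logb 2 (l i) := by
  simp [renyiEntropy]

/-- Rényi entropies of positive order only depend on the nonzero weights. -/
lemma renyiEntropy_subtype_ne_zero {β : ℝ≥0∞} (hβ : β ≠ 0) {l : ι → ℝ} (hl : ∀ i, 0 ≤ l i)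
    (hne : ∃ i, l i ≠ 0) :
    renyiEntropy β (fun i : {i // l i ≠ 0} => l i) = renyiEntropy β l := by
  obtain ⟨i₀, hi₀⟩ := hne
  have : Nonempty {i // l i ≠ 0} := ⟨⟨i₀, hi₀⟩⟩
  have : Nonempty ι := ⟨i₀⟩
  unfold renyiEntropy
  simp only [hβ, if_false]
  split_ifs with h1 h2
  · congr 2
    have hb : BddAbove (Set.range fun i : {i // l i ≠ 0} => l i) := (Set.finite_range _).bddAbove
    refine le_antisymm (ciSup_le fun i => le_ciSup (Set.finite_range l).bddAbove (i : ι))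
      (ciSup_le fun i => ?_)
    by_cases hi : l i = 0
    · rw [hi]
      exact (hl i₀).trans (le_ciSup hb ⟨i₀, hi₀⟩)
    · exact le_ciSup hb ⟨i, hi⟩
  · rw [sum_subtype_ne_zero (f := fun i => l i * Real.logb 2 (l i)) (fun i hi => by simp [hi])]
  · rw [sum_subtype_ne_zero (f := fun i => l i ^ β.toReal) (fun i hi => by
      rw [hi, Real.zero_rpow (ENNReal.toReal_ne_zero.2 ⟨hβ, h1⟩)])]

lemma neg_mul_elog_le {α : ℝ} (hα : α < 1) {t T : ℝ} (ht : t ≤ T) :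
    ((1 / (α - 1) * Real.logb 2 T : ℝ) : EReal) ≤ ((1 / (α - 1) : ℝ) : EReal) * elog t := by
  have hneg : 1 / (α - 1) < 0 := one_div_neg.2 (by linarith)
  unfold elog
  split_ifs with h
  -- Orthogonal states: a negative factor times `-∞` is `+∞`.
  · rw [EReal.coe_mul_bot_of_neg hneg]
    exact le_top
  · push Not at h
    rw [← EReal.coe_mul, EReal.coe_le_coe_iff]
    exact mul_le_mul_of_nonpos_left (Real.logb_le_logb_of_le (by norm_num) h ht) hneg.le

lemma le_pos_mul_elog {α : ℝ} (hα : 1 < α) {t T : ℝ} (hT : 0 < T) (ht : T ≤ t) :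
    ((1 / (α - 1) * Real.logb 2 T : ℝ) : EReal) ≤ ((1 / (α - 1) : ℝ) : EReal) * elog t := by
  have hpos : 0 < 1 / (α - 1) := one_div_pos.2 (by linarith)
  rw [elog, if_neg (by linarith), ← EReal.coe_mul, EReal.coe_le_coe_iff]
  exact mul_le_mul_of_nonneg_left (Real.logb_le_logb_of_le (by norm_num) hT ht) hpos.le

end Values

/-! ### The lower bound over separable states, and Schmidt-diagonal states -/

section Schmidt

variable {m n ι : Type*} [Fintype m] [Fintype n] [DecidableEq m] [DecidableEq n] [Fintype ι]
  {u : ι → EuclideanSpace ℂ m} {v : ι → EuclideanSpace ℂ n}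

/-- The vector with Schmidt coefficients `l` and Schmidt vectors `u`, `v`. -/
def schmidtVec (l : ι → ℝ) (u : ι → EuclideanSpace ℂ m) (v : ι → EuclideanSpace ℂ n) :
    EuclideanSpace ℂ (m × n) :=
  ∑ i, (Real.sqrt (l i) : ℂ) • prodVec (u i) (v i)

/-- The operator with eigenvalues `w` on the product vectors `u i ⊗ v i`. -/
def diagState (w : ι → ℝ) (u : ι → EuclideanSpace ℂ m) (v : ι → EuclideanSpace ℂ n) :
    Matrix (m × n) (m × n) ℂ :=
  ∑ i, (w i : ℂ) • pureState (prodVec (u i) (v i))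

omit [DecidableEq m] [DecidableEq n] in
lemma inner_schmidtVec (l : ι → ℝ) (x : EuclideanSpace ℂ (m × n)) :
    inner ℂ x (schmidtVec l u v)
      = ∑ i, (Real.sqrt (l i) : ℂ) * inner ℂ x (prodVec (u i) (v i)) := by
  simp only [schmidtVec, inner_sum, inner_smul_right]

omit [DecidableEq m] [DecidableEq n] in
lemma norm_schmidtVec_sq (hu : Orthonormal ℂ u) (hv : Orthonormal ℂ v) {l : ι → ℝ}
    (hl : ∀ i, 0 ≤ l i) : ‖schmidtVec l u v‖ ^ 2 = ∑ i, l i := by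
  have h : inner ℂ (schmidtVec l u v) (schmidtVec l u v) = ((∑ i, l i : ℝ) : ℂ) := by
    rw [schmidtVec, (orthonormal_prodVec hu hv).inner_sum, Complex.ofReal_sum]
    refine Finset.sum_congr rfl fun i _ => ?_
    rw [Complex.conj_ofReal, ← Complex.ofReal_mul, Real.mul_self_sqrt (hl i)]
  rw [← inner_self_eq_norm_sq (𝕜 := ℂ), h]
  exact Complex.ofReal_re _

/-- Lower bound on the Rényi relative entropy of a pure state to a separable state. -/
theorem renyiEntropy_le_renyiRelEntropy [Nonempty ι] (hu : Orthonormal ℂ u) (hv : Orthonormal ℂ v)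
    {l : ι → ℝ} (hl : ∀ i, 0 < l i) (hl1 : ∑ i, l i = 1) {α : ℝ≥0} (hα : α ≤ 2)
    {σ : Matrix (m × n) (m × n) ℂ} (hσ : σ ∈ SepStates m n) :
    ((renyiEntropy ((α : ℝ≥0∞)⁻¹) l : ℝ) : EReal)
      ≤ renyiRelEntropy α (pureState (schmidtVec l u v)) σ := by
  have hψ : ‖schmidtVec l u v‖ = 1 := by
    rw [← sq_eq_sq₀ (norm_nonneg _) zero_le_one, norm_schmidtVec_sq hu hv fun i => (hl i).le, hl1,
      one_pow]
  have hpsd := hσ.2.1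
  have hH := hpsd.1
  set μ := hH.eigenvalues with hμdef
  set c : m × n → ι → ℂ := fun k i => inner ℂ (hH.eigenvectorBasis k) (prodVec (u i) (v i)) with hc
  have hiso : IsIsometric c := isIsometric_inner _ (orthonormal_prodVec hu hv)
  have hμ : ∀ k, 0 ≤ μ k := hpsd.eigenvalues_nonneg
  have hoverlap : ∀ (a : ι → ℂ) (C : ℝ), 0 ≤ C → (∀ i, ‖a i‖ ≤ C) →
      ∑ k, μ k * ‖∑ i, a i * c k i‖ ^ 2 ≤ C ^ 2 := by
    intro a C hC ha
    have h := re_trace_pureState_mul_le_of_mem_sepStates hu hv hC ha hσ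
    rw [trace_pureState_mul hH] at h
    simpa only [inner_sum, inner_smul_right] using h
  have h1 : ∀ a : ι → ℂ, (∀ i, ‖a i‖ ≤ 1) → ∑ k, μ k * ‖∑ i, a i * c k i‖ ^ 2 ≤ 1 := fun a ha => by
    simpa using hoverlap a 1 zero_le_one ha
  have hamp : ∀ k, inner ℂ (hH.eigenvectorBasis k) (schmidtVec l u v) = amplitude l c k :=
    fun k => inner_schmidtVec l _
  have hsupp : supp (pureState (schmidtVec l u v)) ≤ supp σ →
      ∀ k, μ k = 0 → amplitude l c k = 0 := fun h k hk =>
    (hamp k).symm.trans (inner_eigenvectorBasis_eq_zero hH (h (mem_supp_pureState hψ)) hk)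
  rcases lt_trichotomy α 1 with hα1 | rfl | hα1
  · rw [renyiEntropy_inv_of_ne_one hα1.ne hl, renyiRelEntropy_pureState hα1.ne hψ hH (Or.inr hα1)]
    refine neg_mul_elog_le (by exact_mod_cast hα1) ?_
    simp only [hamp]
    unfold optTrace
    split_ifs with h0
    · have hle : ∀ i, l i ≤ ⨆ i, l i := fun i => le_ciSup (Set.finite_range l).bddAbove i
      have hsup : 0 ≤ ⨆ i, l i := Real.iSup_nonneg fun i => (hl i).le
      -- For `α = 0` no interpolation is needed: `ψ` itself has coefficients at most `√(max l)`.
      have h := hoverlap (fun i => (Real.sqrt (l i) : ℂ)) (Real.sqrt (⨆ i, l i))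
        (Real.sqrt_nonneg _) (fun i => by
          rw [Complex.norm_real, Real.norm_of_nonneg (Real.sqrt_nonneg _)]
          exact Real.sqrt_le_sqrt (hle i))
      rw [Real.sq_sqrt hsup] at h
      refine le_trans (le_of_eq (Finset.sum_congr rfl fun k _ => ?_)) h
      congr 1
      simp only [rpowSupp, h0, NNReal.coe_zero, sub_zero, Real.rpow_one]
      split_ifs with hk
      · exact hk.symm
      · rfl
    · exact sum_rpowSupp_mul_amplitude_le hμ hiso h1 hl
        (by exact_mod_cast pos_iff_ne_zero.2 h0) (by exact_mod_cast hα1.le)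
  · by_cases h : supp (pureState (schmidtVec l u v)) ≤ supp σ
    · rw [renyiRelEntropy_one_pureState hψ hH h, ENNReal.coe_one, inv_one, renyiEntropy_one,
        EReal.coe_le_coe_iff, neg_le_neg_iff]
      have hlog := sum_log_mul_amplitude_le hμ hiso h1 hl hl1 (hsupp h)
      simp only [hamp, Real.logb, div_mul_eq_mul_div, mul_div_assoc', ← Finset.sum_div]
      exact div_le_div_of_nonneg_right hlog (Real.log_nonneg (by norm_num))
    · rw [renyiRelEntropy, if_pos rfl, if_neg h]
      exact le_top
  · by_cases h : supp (pureState (schmidtVec l u v)) ≤ supp σ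
    · rw [renyiEntropy_inv_of_ne_one hα1.ne' hl, renyiRelEntropy_pureState hα1.ne' hψ hH (Or.inl h)]
      refine le_pos_mul_elog (by exact_mod_cast hα1) (optTrace_pos α hl) ?_
      simp only [hamp]
      rw [optTrace, if_neg (zero_lt_one.trans hα1).ne']
      exact le_sum_rpowSupp_mul_amplitude hμ hiso h1 hl (by exact_mod_cast hα1.le)
        (by exact_mod_cast hα) (hsupp h)
    · rw [renyiRelEntropy, if_neg hα1.ne', if_neg (not_or.2 ⟨h, not_lt.2 hα1.le⟩)]
      exact le_top

lemma diagState_mem_sepStates (hu : Orthonormal ℂ u) (hv : Orthonormal ℂ v) {w : ι → ℝ}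
    (hw : ∀ i, 0 ≤ w i) (hw1 : ∑ i, w i = 1) : diagState w u v ∈ SepStates m n := by
  have hx := orthonormal_prodVec hu hv
  have hsmul : ∀ i, (0 : ℂ) ≤ w i := fun i => by exact_mod_cast hw i
  let e := Fintype.equivFin ι
  refine ⟨⟨Fintype.card ι, fun i => (w (e.symm i) : ℂ) • pureState (u (e.symm i)),
    fun i => pureState (v (e.symm i)), fun i => (posSemidef_pureState _).smul (hsmul _),
    fun i => posSemidef_pureState _, ?_⟩, ?_, ?_⟩
  · simp only [diagState, pureState_prodVec, ← Matrix.smul_kronecker]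
    exact (e.symm.sum_comp fun i => ((w i : ℂ) • pureState (u i)) ⊗ₖ pureState (v i)).symm
  · exact Matrix.posSemidef_sum _ fun i _ => (posSemidef_pureState _).smul (hsmul i)
  · simp only [diagState, Matrix.trace_sum, Matrix.trace_smul, trace_pureState, hx.1]
    simpa using congrArg (fun t : ℝ => (t : ℂ)) hw1

omit [DecidableEq m] [DecidableEq n] in
lemma diagState_mulVec (hu : Orthonormal ℂ u) (hv : Orthonormal ℂ v) (w : ι → ℝ) (i : ι) :
    diagState w u v *ᵥ (prodVec (u i) (v i)).ofLp = (w i : ℂ) • (prodVec (u i) (v i)).ofLp := by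
  classical
  have hx := orthonormal_iff_ite.1 (orthonormal_prodVec hu hv)
  rw [diagState, Matrix.sum_mulVec, Finset.sum_eq_single i]
  · rw [Matrix.smul_mulVec, pureState_mulVec, hx, if_pos rfl, one_smul]
  · intro j _ hj
    rw [Matrix.smul_mulVec, pureState_mulVec, hx, if_neg hj, zero_smul, smul_zero]
  · simp

/-- The relation `hw` forces `μ k = w i` wherever `c k i ≠ 0`, so a function of the operator acts on
the `i`-th vector as `f (w i)`, whichever eigenbasis was chosen in degenerate eigenspaces. -/
lemma sum_mul_norm_amplitude_sq {K : Type*} [Fintype K] {μ : K → ℝ} {c : K → ι → ℂ}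
    (hc : IsIsometric c) {l w : ι → ℝ} (hl : ∀ i, 0 ≤ l i)
    (hw : ∀ k i, (μ k : ℂ) * c k i = (w i : ℂ) * c k i) (f : ℝ → ℝ) :
    ∑ k, f (μ k) * ‖amplitude l c k‖ ^ 2 = ∑ i, l i * f (w i) := by
  have h := hc (fun i => (Real.sqrt (l i) : ℂ)) fun i => (f (w i) * Real.sqrt (l i) : ℝ)
  have hleft : ∀ k, star (∑ i, (Real.sqrt (l i) : ℂ) * c k i) *
      ∑ i, ((f (w i) * Real.sqrt (l i) : ℝ) : ℂ) * c k i
        = ((f (μ k) * ‖amplitude l c k‖ ^ 2 : ℝ) : ℂ) := by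
    intro k
    have hk : ∑ i, ((f (w i) * Real.sqrt (l i) : ℝ) : ℂ) * c k i
        = (f (μ k) : ℂ) * amplitude l c k := by
      rw [amplitude, Finset.mul_sum]
      refine Finset.sum_congr rfl fun i _ => ?_
      by_cases hz : c k i = 0
      · simp [hz]
      · rw [Complex.ofReal_inj.1 (mul_right_cancel₀ hz (hw k i))]
        push_cast
        ring
    rw [hk, ← amplitude, mul_left_comm, Complex.star_def, Complex.conj_mul']
    push_cast
    rfl
  simp only [hleft] at h
  simp only [Complex.star_def, Complex.conj_ofReal, ← Complex.ofReal_mul, ← Complex.ofReal_sum,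
    Complex.ofReal_inj] at h
  rw [h]
  refine Finset.sum_congr rfl fun i _ => ?_
  rw [mul_left_comm, Real.mul_self_sqrt (hl i), mul_comm]

end Schmidt

/-! ### Optimal states -/

section Attainment

variable {m n ι : Type*} [Fintype m] [Fintype n] [DecidableEq m] [DecidableEq n] [Fintype ι]
  {u : ι → EuclideanSpace ℂ m} {v : ι → EuclideanSpace ℂ n}

/-- Rényi relative entropy of a vector to a state diagonal in its Schmidt basis. -/
lemma renyiRelEntropy_diagState (hu : Orthonormal ℂ u) (hv : Orthonormal ℂ v) {l w : ι → ℝ}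
    (hl : ∀ i, 0 ≤ l i) (hl1 : ∑ i, l i = 1) (hw : ∀ i, 0 ≤ w i) (hw1 : ∑ i, w i = 1) {α : ℝ≥0}
    (h : (∀ i, w i ≠ 0) ∨ α < 1) :
    renyiRelEntropy α (pureState (schmidtVec l u v)) (diagState w u v) =
      if α = 1 then ((-∑ i, l i * Real.logb 2 (w i) : ℝ) : EReal)
      else ((1 / ((α : ℝ) - 1) : ℝ) : EReal) * elog (∑ i, l i * rpowSupp (1 - α) (w i)) := by
  have hψ : ‖schmidtVec l u v‖ = 1 := by
    rw [← sq_eq_sq₀ (norm_nonneg _) zero_le_one, norm_schmidtVec_sq hu hv hl, hl1, one_pow]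
  have hH := (diagState_mem_sepStates hu hv hw hw1).2.1.1
  have hiso : IsIsometric fun k i => inner ℂ (hH.eigenvectorBasis k) (prodVec (u i) (v i)) :=
    isIsometric_inner _ (orthonormal_prodVec hu hv)
  have heig : ∀ k i, (hH.eigenvalues k : ℂ) * inner ℂ (hH.eigenvectorBasis k) (prodVec (u i) (v i))
      = (w i : ℂ) * inner ℂ (hH.eigenvectorBasis k) (prodVec (u i) (v i)) := by
    intro k i
    have h := inner_eigenvectorBasis_mulVec hH (prodVec (u i) (v i)).ofLp k
    rw [diagState_mulVec hu hv, WithLp.toLp_smul, inner_smul_right] at h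
    exact h.symm
  have hval := sum_mul_norm_amplitude_sq hiso hl heig
  have hsupp : (∀ i, w i ≠ 0) →
      supp (pureState (schmidtVec l u v)) ≤ supp (diagState w u v) := by
    intro hne
    refine supp_pureState_le ?_
    simp only [schmidtVec, WithLp.ofLp_sum, WithLp.ofLp_smul]
    refine Submodule.sum_mem _ fun i _ => Submodule.smul_mem _ _ ?_
    refine ⟨(w i : ℂ)⁻¹ • (prodVec (u i) (v i)).ofLp, ?_⟩
    rw [map_smul, Matrix.mulVecLin_apply, diagState_mulVec hu hv, smul_smul,
      inv_mul_cancel₀ (by exact_mod_cast hne i), one_smul]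
  split_ifs with h1
  · subst h1
    rw [renyiRelEntropy_one_pureState hψ hH (hsupp (h.resolve_right (lt_irrefl _)))]
    simp only [inner_schmidtVec]
    rw [← hval]
    rfl
  · rw [renyiRelEntropy_pureState h1 hψ hH (h.imp_left hsupp)]
    simp only [inner_schmidtVec]
    rw [← hval]
    rfl

/-- The weights of the optimal diagonal state for `α ≠ 0`. -/
def optWeight (α : ℝ≥0) (l : ι → ℝ) (i : ι) : ℝ :=
  l i ^ (1 / (α : ℝ)) / ∑ j, l j ^ (1 / (α : ℝ))

lemma renyiRelEntropy_diagState_optWeight [Nonempty ι] (hu : Orthonormal ℂ u)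
    (hv : Orthonormal ℂ v) {l : ι → ℝ} (hl : ∀ i, 0 < l i) (hl1 : ∑ i, l i = 1) {α : ℝ≥0}
    (hα : α ≠ 0) : diagState (optWeight α l) u v ∈ SepStates m n ∧
      renyiRelEntropy α (pureState (schmidtVec l u v)) (diagState (optWeight α l) u v)
        = (renyiEntropy ((α : ℝ≥0∞)⁻¹) l : EReal) := by
  set Z := ∑ j, l j ^ (1 / (α : ℝ)) with hZ
  have hZpos : 0 < Z := Finset.sum_pos (fun i _ => Real.rpow_pos_of_pos (hl i) _)
    Finset.univ_nonempty
  have hw : ∀ i, 0 < optWeight α l i := fun i => div_pos (Real.rpow_pos_of_pos (hl i) _) hZpos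
  have hw1 : ∑ i, optWeight α l i = 1 := by
    simp only [optWeight]
    rw [← Finset.sum_div, ← hZ, div_self hZpos.ne']
  have hα0 : (α : ℝ) ≠ 0 := by exact_mod_cast hα
  refine ⟨diagState_mem_sepStates hu hv (fun i => (hw i).le) hw1, ?_⟩
  rw [renyiRelEntropy_diagState hu hv (fun i => (hl i).le) hl1 (fun i => (hw i).le) hw1
    (Or.inl fun i => (hw i).ne')]
  split_ifs with h1
  · subst h1
    rw [ENNReal.coe_one, inv_one, renyiEntropy_one]
    simp [optWeight, hl1]
  · rw [renyiEntropy_inv_of_ne_one h1 hl]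
    -- Each term is `l_i (l_i^(1/α) / Z)^(1-α) = Z^(α-1) l_i^(1/α)`.
    have hsum : ∑ i, l i * rpowSupp (1 - α) (optWeight α l i) = optTrace α l := by
      rw [optTrace, if_neg hα, ← hZ]
      have hZα : Z ^ (α : ℝ) = Z ^ ((α : ℝ) - 1) * Z := by
        rw [← Real.rpow_add_one hZpos.ne', sub_add_cancel]
      rw [hZα]
      nth_rw 2 [hZ]
      rw [Finset.mul_sum]
      refine Finset.sum_congr rfl fun i _ => ?_
      rw [rpowSupp, if_neg (hw i).ne', optWeight, ← hZ,
        Real.div_rpow (Real.rpow_nonneg (hl i).le _) hZpos.le, ← Real.rpow_mul (hl i).le,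
        div_eq_mul_inv, ← Real.rpow_neg hZpos.le, neg_sub, mul_comm (Z ^ _), ← mul_assoc]
      congr 1
      nth_rw 1 [← Real.rpow_one (l i)]
      rw [← Real.rpow_add (hl i)]
      congr 1
      field_simp
      ring
    rw [hsum, elog, if_neg (not_le.2 (optTrace_pos α hl)), EReal.coe_mul]

lemma renyiRelEntropy_zero_prodVec (hu : Orthonormal ℂ u) (hv : Orthonormal ℂ v) {l : ι → ℝ}
    (hl : ∀ i, 0 < l i) (hl1 : ∑ i, l i = 1) {i₀ : ι} (hi₀ : ∀ i, l i ≤ l i₀) :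
    pureState (prodVec (u i₀) (v i₀)) ∈ SepStates m n ∧
      renyiRelEntropy 0 (pureState (schmidtVec l u v)) (pureState (prodVec (u i₀) (v i₀)))
        = (renyiEntropy (((0 : ℝ≥0) : ℝ≥0∞)⁻¹) l : EReal) := by
  classical
  have : Nonempty ι := ⟨i₀⟩
  have hw : ∀ i, 0 ≤ (Pi.single i₀ 1 : ι → ℝ) i := fun i => by
    rw [Pi.single_apply]
    split_ifs <;> norm_num
  have hw1 : ∑ i, (Pi.single i₀ 1 : ι → ℝ) i = 1 := by simp
  have hst : diagState (Pi.single i₀ 1) u v = pureState (prodVec (u i₀) (v i₀)) := by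
    rw [diagState, Finset.sum_eq_single i₀]
    · simp
    · intro j _ hj
      simp [hj]
    · simp
  rw [← hst]
  refine ⟨diagState_mem_sepStates hu hv hw hw1, ?_⟩
  -- The weights away from `i₀` vanish, so support inclusion may fail; the alternative `α < 1` makes
  -- it unnecessary.
  rw [renyiRelEntropy_diagState hu hv (fun i => (hl i).le) hl1 hw hw1 (Or.inr zero_lt_one),
    if_neg zero_ne_one, renyiEntropy_inv_of_ne_one zero_ne_one hl]
  have hsum : ∑ i, l i * rpowSupp (1 - (0 : ℝ≥0)) ((Pi.single i₀ 1 : ι → ℝ) i)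
      = optTrace 0 l := by
    rw [optTrace, if_pos rfl, Finset.sum_eq_single i₀]
    · simp only [Pi.single_eq_same, rpowSupp, one_ne_zero, if_false, Real.one_rpow, mul_one]
      exact le_antisymm (le_ciSup (Set.finite_range l).bddAbove i₀) (ciSup_le hi₀)
    · intro j _ hj
      simp [hj, rpowSupp]
    · simp
  rw [hsum, elog, if_neg (not_le.2 (optTrace_pos 0 hl)), EReal.coe_mul]

/-- The relative entropy of entanglement of a vector with positive Schmidt coefficients. -/
theorem relEntanglement_schmidtVec (hu : Orthonormal ℂ u) (hv : Orthonormal ℂ v) {l : ι → ℝ}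
    (hl : ∀ i, 0 < l i) (hl1 : ∑ i, l i = 1) {α : ℝ≥0} (hα : α ≤ 2) :
    relEntanglement α (pureState (schmidtVec l u v)) = (renyiEntropy ((α : ℝ≥0∞)⁻¹) l : EReal) := by
  have hne : Nonempty ι := by
    by_contra h
    rw [not_nonempty_iff] at h
    simp at hl1
  refine le_antisymm ?_ (le_iInf₂ fun σ hσ => renyiEntropy_le_renyiRelEntropy hu hv hl hl1 hα hσ)
  by_cases h0 : α = 0
  · subst h0
    obtain ⟨i₀, hi₀⟩ := Finite.exists_max l
    obtain ⟨h1, h2⟩ := renyiRelEntropy_zero_prodVec hu hv hl hl1 hi₀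
    exact h2 ▸ iInf₂_le _ h1
  · obtain ⟨h1, h2⟩ := renyiRelEntropy_diagState_optWeight hu hv hl hl1 h0
    exact h2 ▸ iInf₂_le _ h1

end Attainment

/-! ### Existence of Schmidt decompositions -/

section Existence

variable {m n : Type*} [Fintype m] [Fintype n] [DecidableEq m]

lemma schmidtCoeff_nonneg (ψ : EuclideanSpace ℂ (m × n)) (k : Fin (Fintype.card m)) :
    0 ≤ schmidtCoeff ψ k := by
  have h := (Matrix.posSemidef_self_mul_conjTranspose (coeffMatrix ψ)).eigenvalues_nonneg
    (Fintype.equivOfCardEq (Fintype.card_fin _) k)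
  simp only [Matrix.IsHermitian.eigenvalues, Equiv.symm_apply_apply] at h
  exact h

/-- Every vector has a Schmidt decomposition over its nonzero Schmidt coefficients. -/
theorem exists_schmidtVec_eq (ψ : EuclideanSpace ℂ (m × n)) :
    ∃ (u : {k // schmidtCoeff ψ k ≠ 0} → EuclideanSpace ℂ m)
      (v : {k // schmidtCoeff ψ k ≠ 0} → EuclideanSpace ℂ n), Orthonormal ℂ u ∧ Orthonormal ℂ v ∧
        ψ = schmidtVec (fun k : {k // schmidtCoeff ψ k ≠ 0} => schmidtCoeff ψ k) u v := by
  set M := coeffMatrix ψ with hM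
  have hH := Matrix.isHermitian_mul_conjTranspose_self M
  let e : Fin (Fintype.card m) ≃ m := Fintype.equivOfCardEq (Fintype.card_fin _)
  have hlam : ∀ k, hH.eigenvalues (e k) = schmidtCoeff ψ k := fun k => by
    simp [Matrix.IsHermitian.eigenvalues, schmidtCoeff, e, hM]
  let b := hH.eigenvectorBasis.reindex e.symm
  have hb : ∀ k, b k = hH.eigenvectorBasis (e k) := fun k => by simp [b]
  have hpos : ∀ k : {k // schmidtCoeff ψ k ≠ 0}, 0 < schmidtCoeff ψ k := fun k =>
    (schmidtCoeff_nonneg ψ k).lt_of_ne' k.2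
  -- The component of `ψ` along `b k`; these vectors are orthogonal with squared norms the
  -- eigenvalues of `M Mᴴ`, so normalising the nonzero ones gives the right Schmidt vectors.
  let g : Fin (Fintype.card m) → EuclideanSpace ℂ n := fun k =>
    WithLp.toLp 2 (star (b k).ofLp ᵥ* M)
  have hg : ∀ k l, inner ℂ (g k) (g l) = if k = l then (schmidtCoeff ψ k : ℂ) else 0 := by
    intro k l
    have h1 : inner ℂ (g k) (g l) = star (b l).ofLp ⬝ᵥ ((M * Mᴴ) *ᵥ (b k).ofLp) := by
      rw [EuclideanSpace.inner_eq_star_dotProduct]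
      simp only [g]
      rw [Matrix.star_vecMul, star_star, ← Matrix.dotProduct_mulVec, Matrix.mulVec_mulVec]
    rw [h1, hb k, hH.mulVec_eigenvectorBasis, ← hb, hlam, dotProduct_smul, dotProduct_comm,
      ← EuclideanSpace.inner_eq_star_dotProduct, orthonormal_iff_ite.1 b.orthonormal]
    by_cases hkl : k = l
    · simp [hkl]
    · simp [hkl, Ne.symm hkl]
  refine ⟨fun k => b k, fun k => ((Real.sqrt (schmidtCoeff ψ k))⁻¹ : ℂ) • g k,
    b.orthonormal.comp _ Subtype.val_injective, ?_, ?_⟩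
  · rw [orthonormal_iff_ite]
    intro k l
    rw [inner_smul_left, inner_smul_right, hg]
    by_cases hkl : k = l
    · subst hkl
      rw [if_pos rfl, if_pos rfl, map_inv₀, Complex.conj_ofReal, ← Complex.ofReal_inv,
        ← Complex.ofReal_mul, ← Complex.ofReal_mul, ← mul_assoc, ← mul_inv,
        Real.mul_self_sqrt (hpos k).le, inv_mul_cancel₀ (hpos k).ne', Complex.ofReal_one]
    · rw [if_neg (fun h => hkl (Subtype.ext h)), if_neg hkl, mul_zero, mul_zero]
  -- Expand each column of the coefficient matrix in the eigenbasis `b`.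
  · have hfull : ψ = ∑ k, prodVec (b k) (g k) := by
      ext ⟨i, j⟩
      have h := congrArg (fun x : EuclideanSpace ℂ m => x i)
        (b.sum_repr' (WithLp.toLp 2 fun i => M i j))
      simp only [WithLp.ofLp_sum, WithLp.ofLp_smul, Finset.sum_apply, Pi.smul_apply] at h
      change _ = ψ (i, j) at h
      rw [← h]
      simp only [WithLp.ofLp_sum, Finset.sum_apply, prodVec, g]
      refine Finset.sum_congr rfl fun k _ => ?_
      rw [EuclideanSpace.inner_eq_star_dotProduct, dotProduct_comm, smul_eq_mul, mul_comm]
      rfl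
    have hzero : ∀ k, schmidtCoeff ψ k = 0 → g k = 0 := fun k hk => by
      rw [← inner_self_eq_zero (𝕜 := ℂ), hg, if_pos rfl, hk, Complex.ofReal_zero]
    have hterm : ∀ k : {k // schmidtCoeff ψ k ≠ 0}, (Real.sqrt (schmidtCoeff ψ k) : ℂ) •
        prodVec (b k) (((Real.sqrt (schmidtCoeff ψ k))⁻¹ : ℂ) • g k) = prodVec (b k) (g k) := by
      intro k
      have hs : (Real.sqrt (schmidtCoeff ψ k) : ℂ) ≠ 0 := by
        exact_mod_cast (Real.sqrt_pos.2 (hpos k)).ne'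
      ext ⟨i, j⟩
      simp only [prodVec, WithLp.ofLp_smul, Pi.smul_apply, smul_eq_mul]
      field_simp
    nth_rw 1 [hfull]
    simp only [schmidtVec, hterm]
    refine (sum_subtype_ne_zero (f := fun k => prodVec (b k) (g k)) fun k hk => ?_).symm
    ext p
    simp [prodVec, hzero k hk]

end Existence

/-! ### Arbitrary unit vectors and Schmidt decompositions with zeros -/

variable {m n : Type*} [Fintype m] [Fintype n] [DecidableEq m] [DecidableEq n]
  {ψ : EuclideanSpace ℂ (m × n)} {α : ℝ≥0}

theorem relEntanglement_pureState (hψ : ‖ψ‖ = 1) (hα : α ≤ 2) :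
    relEntanglement α (pureState ψ) = (renyiEntanglement ((α : ℝ≥0∞)⁻¹) ψ : EReal) := by
  -- Since `α` is finite the entropy has positive order, so zero coefficients can be dropped.
  have hβ : (α : ℝ≥0∞)⁻¹ ≠ 0 := by simp
  obtain ⟨u, v, hu, hv, hdec⟩ := exists_schmidtVec_eq ψ
  have hpos : ∀ k : {k // schmidtCoeff ψ k ≠ 0}, 0 < schmidtCoeff ψ k := fun k =>
    (schmidtCoeff_nonneg ψ k).lt_of_ne' k.2
  have hsum : ∑ k : {k // schmidtCoeff ψ k ≠ 0}, schmidtCoeff ψ k = 1 := by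
    rw [← norm_schmidtVec_sq hu hv fun k => (hpos k).le, ← hdec, hψ, one_pow]
  have hne : ∃ k, schmidtCoeff ψ k ≠ 0 := by
    by_contra! h
    simp [h] at hsum
  nth_rw 1 [hdec]
  rw [relEntanglement_schmidtVec hu hv hpos hsum hα,
    renyiEntropy_subtype_ne_zero hβ (schmidtCoeff_nonneg ψ) hne]
  rfl

theorem IsSchmidtDecomposition.isOptimal (hψ : ‖ψ‖ = 1) (hα : α ≤ 2) {d : ℕ} {l : Fin d → ℝ}
    {u : Fin d → EuclideanSpace ℂ m} {v : Fin d → EuclideanSpace ℂ n}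
    (hs : IsSchmidtDecomposition ψ l u v) :
    renyiEntanglement ((α : ℝ≥0∞)⁻¹) ψ = renyiEntropy ((α : ℝ≥0∞)⁻¹) l ∧
      (α ≠ 0 → IsOptimal α (pureState ψ) (schmidtDiagState α l u v)) ∧
      (α = 0 → ∀ hd : 0 < d, IsOptimal α (pureState ψ)
        (pureState (prodVec (u ⟨0, hd⟩) (v ⟨0, hd⟩)))) := by
  have hβ : (α : ℝ≥0∞)⁻¹ ≠ 0 := by simp
  let P := {i // l i ≠ 0}
  have hu : Orthonormal ℂ fun i : P => u i := hs.orthonormal_left.comp _ Subtype.val_injective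
  have hv : Orthonormal ℂ fun i : P => v i := hs.orthonormal_right.comp _ Subtype.val_injective
  have hpos : ∀ i : P, 0 < l i := fun i => (hs.nonneg i).lt_of_ne' i.2
  have hdec : ψ = schmidtVec (fun i : P => l i) (fun i => u i) fun i => v i := by
    rw [schmidtVec, sum_subtype_ne_zero (f := fun i => (Real.sqrt (l i) : ℂ) • prodVec (u i) (v i))
      fun i hi => by simp [hi]]
    exact hs.expansion
  have hsum : ∑ i : P, l i = 1 := by
    rw [← norm_schmidtVec_sq hu hv fun k => (hpos k).le, ← hdec, hψ, one_pow]
  have hne : ∃ i, l i ≠ 0 := by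
    by_contra! h
    have : IsEmpty P := ⟨fun i => i.2 (h i)⟩
    simp at hsum
  have : Nonempty P := ⟨⟨_, hne.choose_spec⟩⟩
  have hval := relEntanglement_schmidtVec hu hv hpos hsum hα
  rw [← hdec] at hval
  have heq : renyiEntropy ((α : ℝ≥0∞)⁻¹) (fun i : P => l i) = renyiEntropy ((α : ℝ≥0∞)⁻¹) l :=
    renyiEntropy_subtype_ne_zero hβ hs.nonneg hne
  refine ⟨?_, fun h0 => ?_, fun h0 hd => ?_⟩
  -- Both entropies equal the same relative entropy of entanglement, so uniqueness of Schmidt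
  -- coefficients is not needed.
  · rw [← heq, ← EReal.coe_eq_coe_iff, ← relEntanglement_pureState hψ hα, hval]
  -- With a nonzero exponent `0^(1/α) = 0`, so zero coefficients add nothing to the state or its
  -- normalisation.
  · have hα0 : (1 / (α : ℝ)) ≠ 0 := one_div_ne_zero (by exact_mod_cast h0)
    have hst : schmidtDiagState α l u v
        = diagState (optWeight α fun i : P => l i) (fun i => u i) fun i => v i := by
      unfold schmidtDiagState diagState optWeight
      rw [sum_subtype_ne_zero (f := fun i => l i ^ (1 / (α : ℝ))) fun i hi => by
        rw [hi, Real.zero_rpow hα0]]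
      exact (sum_subtype_ne_zero (f := fun i => ((l i ^ (1 / (α : ℝ)) /
        ∑ j, l j ^ (1 / (α : ℝ)) : ℝ) : ℂ) • pureState (prodVec (u i) (v i))) fun i hi => by
          rw [hi, Real.zero_rpow hα0, zero_div, Complex.ofReal_zero, zero_smul]).symm
    obtain ⟨h1, h2⟩ := renyiRelEntropy_diagState_optWeight hu hv hpos hsum h0
    rw [← hdec, ← hval] at h2
    exact ⟨hst ▸ h1, hst ▸ h2⟩
  · subst h0
    obtain ⟨j, hj⟩ := hne
    have hmax : ∀ i, l i ≤ l ⟨0, hd⟩ := fun i => hs.decreasing (Nat.zero_le _)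
    -- The first coefficient dominates a nonzero one, so its index survives the restriction to `P`.
    have h0 : l ⟨0, hd⟩ ≠ 0 := (((hs.nonneg j).lt_of_ne' hj).trans_le (hmax j)).ne'
    obtain ⟨h1, h2⟩ := renyiRelEntropy_zero_prodVec hu hv hpos hsum (i₀ := ⟨⟨0, hd⟩, h0⟩)
      fun i => hmax i
    rw [← hdec, ← hval] at h2
    exact ⟨h1, h2⟩

end RenyiEnt

end

theorem mainTheorem8 {m n : Type*} [Fintype m] [Fintype n] [DecidableEq m] [DecidableEq n]
    (ψ : EuclideanSpace ℂ (m × n)) (hψ : ‖ψ‖ = 1) (α : ℝ≥0) (hα : α ≤ 2) :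
    RenyiEnt.relEntanglement α (RenyiEnt.pureState ψ)
        = (RenyiEnt.renyiEntanglement ((α : ℝ≥0∞)⁻¹) ψ : EReal) ∧
    ∀ (d : ℕ) (l : Fin d → ℝ) (u : Fin d → EuclideanSpace ℂ m) (v : Fin d → EuclideanSpace ℂ n),
      RenyiEnt.IsSchmidtDecomposition ψ l u v →
        RenyiEnt.renyiEntanglement ((α : ℝ≥0∞)⁻¹) ψ
          = RenyiEnt.renyiEntropy ((α : ℝ≥0∞)⁻¹) l ∧
        (α ≠ 0 → RenyiEnt.IsOptimal α (RenyiEnt.pureState ψ)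
          (RenyiEnt.schmidtDiagState α l u v)) ∧
        (α = 0 → ∀ hd : 0 < d, RenyiEnt.IsOptimal α (RenyiEnt.pureState ψ)
          (RenyiEnt.pureState (RenyiEnt.prodVec (u ⟨0, hd⟩) (v ⟨0, hd⟩)))) := by
  exact ⟨RenyiEnt.relEntanglement_pureState hψ hα, fun _ _ _ _ hs => hs.isOptimal hψ hα⟩
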